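/- **Setting.** Let $a,b,c$ be real polynomials and $\alpha>0$ with $a(x)\ge\alpha$ for all $x\in[0,1]$. Write $\|f\|=\big(\int_0^1 f(x)^2dx\big)^{1/2}$, and let $D_1,D_2$ denote the partial derivatives with respect to the first and second variable. *The set $\Xi_{d_1,d_2,\epsilon}$.* For $d_1,d_2\in\mathbb N$ let $Z_1(x)$ be the vector of monomials $1,x,\dots,x^{d_1}$ and $Z_2(x,y)$ the vector of all monomials in $x,y$ of total degree at most $d_2$. For $\epsilon\ge 0$, polynomials $M(x),K_1(x,\xi),K_2(x,\xi)$ satisfy $\{M,K_1,K_2\}\in\Xi_{d_1,d_2,\epsilon}$ if there is a real symmetric block matrix $P=(P_{ij})_{1\le i,j\le 3}$, with blocks of sizes given by the lengths of $Z_1,Z_2,Z_2$, such that $P-\epsilon E\ge 0$ (positive semidefinite), where $E$ has a single nonzero entry, equal to $1$, at the diagonal position of the monomial $1$ of $Z_1$, and $$M(x)=Z_1(x)^TP_{11}Z_1(x),$$ $$K_1(x,\xi)=Z_1(x)^TP_{12}Z_2(x,\xi)+Z_2(\xi,x)^TP_{31}Z_1(\xi)+\int_0^{\xi}Z_2(\eta,x)^TP_{33}Z_2(\eta,\xi)\,d\eta+\int_\xi^xZ_2(\eta,x)^TP_{32}Z_2(\eta,\xi)\,d\eta+\int_x^1Z_2(\eta,x)^TP_{22}Z_2(\eta,\xi)\,d\eta,$$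 $$K_2(x,\xi)=K_1(\xi,x).$$ *The maps $\Omega_c$ and $\Omega_s$ (for given $\epsilon$).* $\Omega_c(M,K_1,K_2)=\{\hat M,\hat K_1,\hat K_2\}$ with $$\hat M=(a_{xx}-b_x)M+bM_x+aM_{xx}+2cM-\tfrac{\pi^2}{2}\alpha\epsilon+2a(x)\big[D_1(K_1-K_2)\big](x,x),$$ $$\hat K_1(x,\xi)=a(x)D_1^2K_1+b(x)D_1K_1+a(\xi)D_2^2K_1+b(\xi)D_2K_1+(c(x)+c(\xi))K_1,\qquad \hat K_2(x,\xi)=\hat K_1(\xi,x).$$ $\Omega_s(N,S_1,S_2)=\{\hat N,\hat S_1,\hat S_2\}$ with $$\hat N=\big[(aN)_x-bN\big]_x+2\Big[\partial_x\big(a(x)(S_1(x,\xi)-S_2(x,\xi))\big)\Big]_{\xi=x}+2cN-\tfrac{\pi^2}{2}\alpha\epsilon,$$ $$\hat S_1(x,\xi)=\partial_x\big[\partial_x(a(x)S_1)-b(x)S_1\big]+\partial_\xi\big[\partial_\xi(a(\xi)S_1)-b(\xi)S_1\big]+(c(x)+c(\xi))S_1,\qquad \hat S_2(x,\xi)=\hat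 S_1(\xi,x).$$ **Theorem.** Let $d_1,d_2,\hat d_1,\hat d_2\in\mathbb N$ and $\epsilon,\delta,\mu>0$, and suppose that there are polynomials $M,N$ in $x$ and $K_1,K_2,S_1,S_2$ in $(x,\xi)$ such that $$\{M,K_1,K_2\}\in\Xi_{d_1,d_2,\epsilon},\quad \{-\hat M-2\mu M,-\hat K_1-2\mu K_1,-\hat K_2-2\mu K_2\}\in\Xi_{\hat d_1,\hat d_2,0},\quad K_2(0,x)=0,$$ $$\{N,S_1,S_2\}\in\Xi_{d_1,d_2,\epsilon},\quad \{-\hat N-2\delta N,-\hat S_1-2\delta S_1,-\hat S_2-2\delta S_2\}\in\Xi_{\hat d_1,\hat d_2,0},\quad S_2(0,x)=0,$$ where $\{\hat M,\hat K_1,\hat K_2\}=\Omega_c(M,K_1,K_2)$ and $\{\hat N,\hat S_1,\hat S_2\}=\Omega_s(N,S_1,S_2)$. Then there exist gains $R_1,L_2\in\mathbb R$ and $R_2,L_1\in C^\infty([0,1])$ and a constant $\gamma>0$ such that the following holds for every $\kappa$ with $0<\kappa<\min\{\mu,\delta\}$. Let $w$ and $\hat w$ be functions of $(x,t)\in[0,1]\times[0,\infty)$,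 once continuously differentiable in $t$ and twice in $x$ on $[0,1]\times(0,\infty)$ (with $w,w_t,w_x,w_{xx}$ and $\hat w,\hat w_t,\hat w_x,\hat w_{xx}$ jointly continuous there), whose initial states lie in $L_2(0,1)$ and are attained in $L_2(0,1)$ as $t\to0^+$, with $\hat w(\cdot,0)=0$, and which satisfy for $t>0$ and $x\in[0,1]$ $$w_t=aw_{xx}+bw_x+cw,\qquad w(0,t)=0,\qquad w_x(1,t)=u(t),$$ $$\hat w_t=a\hat w_{xx}+b\hat w_x+c\hat w+L_1(x)\big(\hat w(1,t)-w(1,t)\big),\qquad \hat w(0,t)=0,\qquad \hat w_x(1,t)=u(t)+L_2\big(\hat w(1,t)-w(1,t)\big),$$ $$u(t)=R_1\hat w(1,t)+\int_0^1R_2(x)\hat w(x,t)\,dx.$$ Then $\|w(\cdot,t)\|\le\gamma\,\|w(\cdot,0)\|\,e^{-\kappa t}$ for all $t\ge0$. -/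

import Mathlib

open scoped ContDiff

noncomputable section

namespace ParabolicSOS

open Matrix

/-! ### Polynomials in one and two variables

Bivariate polynomials `K(x, ξ)` are elements of `MvPolynomial (Fin 2) ℝ`; variable `0` is `x` and
variable `1` is `ξ`. -/

/-- Real polynomials in the two variables `x` (index `0`) and `ξ` (index `1`). -/
abbrev BiPoly : Type := MvPolynomial (Fin 2) ℝ

/-- The value `K(x, ξ)`. -/
def BiPoly.val (K : BiPoly) (x ξ : ℝ) : ℝ := MvPolynomial.eval ![x, ξ] K

/-- `p(x)` as a polynomial in `(x, ξ)`. -/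
def inX (p : Polynomial ℝ) : BiPoly := Polynomial.aeval (MvPolynomial.X 0) p

/-- `p(ξ)` as a polynomial in `(x, ξ)`. -/
def inXi (p : Polynomial ℝ) : BiPoly := Polynomial.aeval (MvPolynomial.X 1) p

/-- The polynomial `(x, ξ) ↦ K(ξ, x)`. -/
def swapVars (K : BiPoly) : BiPoly := MvPolynomial.rename (Equiv.swap (0 : Fin 2) 1) K

/-- The restriction to the diagonal, `x ↦ K(x, x)`. -/
def onDiag (K : BiPoly) : Polynomial ℝ := MvPolynomial.aeval (fun _ => Polynomial.X) K

/-- Partial derivative with respect to the first variable. -/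
def D₁ (K : BiPoly) : BiPoly := MvPolynomial.pderiv 0 K

/-- Partial derivative with respect to the second variable. -/
def D₂ (K : BiPoly) : BiPoly := MvPolynomial.pderiv 1 K

/-! ### The cone `Ξ` -/

/-- Index type of the monomials `x ^ i * y ^ j` with `i + j ≤ d`. -/
abbrev Mon₂ (d : ℕ) : Type := {p : Fin (d + 1) × Fin (d + 1) // (p.1 : ℕ) + (p.2 : ℕ) ≤ d}

/-- The vector of monomials `1, x, …, x ^ d`. -/
def Z₁ (d : ℕ) (x : ℝ) : Fin (d + 1) → ℝ := fun i => x ^ (i : ℕ)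

/-- The vector of all monomials in `x, y` of total degree at most `d`. -/
def Z₂ (d : ℕ) (x y : ℝ) : Mon₂ d → ℝ := fun p => x ^ (p.1.1 : ℕ) * y ^ (p.1.2 : ℕ)

/-- Index type of the block matrix `P = (P_ij)`, `1 ≤ i, j ≤ 3`. -/
abbrev BlockIdx (d₁ d₂ : ℕ) : Type := Fin (d₁ + 1) ⊕ Mon₂ d₂ ⊕ Mon₂ d₂

/-- Embedding of the first block of indices. -/
def blk₁ {d₁ d₂ : ℕ} (i : Fin (d₁ + 1)) : BlockIdx d₁ d₂ := Sum.inl i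

/-- Embedding of the second block of indices. -/
def blk₂ {d₁ d₂ : ℕ} (i : Mon₂ d₂) : BlockIdx d₁ d₂ := Sum.inr (Sum.inl i)

/-- Embedding of the third block of indices. -/
def blk₃ {d₁ d₂ : ℕ} (i : Mon₂ d₂) : BlockIdx d₁ d₂ := Sum.inr (Sum.inr i)

/-- Membership `{M, K₁, K₂} ∈ Ξ_{d₁, d₂, ε}`: the triple is generated by a symmetric block matrix
`P` for which `P - ε E` is positive semidefinite, where `E` has the single nonzero entry `1` at the
position of the monomial `1` in the first diagonal block. -/
def MemXi (d₁ d₂ : ℕ) (ε : ℝ) (M : Polynomial ℝ) (K₁ K₂ : BiPoly) : Prop :=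
  ∃ P : Matrix (BlockIdx d₁ d₂) (BlockIdx d₁ d₂) ℝ,
    (P - Matrix.single (blk₁ 0) (blk₁ 0) ε).PosSemidef ∧
    (∀ x : ℝ, M.eval x = Z₁ d₁ x ⬝ᵥ (P.submatrix blk₁ blk₁ *ᵥ Z₁ d₁ x)) ∧
    (∀ x ξ : ℝ, K₁.val x ξ =
      Z₁ d₁ x ⬝ᵥ (P.submatrix blk₁ blk₂ *ᵥ Z₂ d₂ x ξ)
      + Z₂ d₂ ξ x ⬝ᵥ (P.submatrix blk₃ blk₁ *ᵥ Z₁ d₁ ξ)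
      + (∫ η in (0 : ℝ)..ξ, Z₂ d₂ η x ⬝ᵥ (P.submatrix blk₃ blk₃ *ᵥ Z₂ d₂ η ξ))
      + (∫ η in ξ..x, Z₂ d₂ η x ⬝ᵥ (P.submatrix blk₃ blk₂ *ᵥ Z₂ d₂ η ξ))
      + (∫ η in x..1, Z₂ d₂ η x ⬝ᵥ (P.submatrix blk₂ blk₂ *ᵥ Z₂ d₂ η ξ))) ∧
    K₂ = swapVars K₁

/-! ### The maps `Ω_c` and `Ω_s` -/

/-- First component `M̂` of `Ω_c(M, K₁, K₂)`. -/
def OmegaC.M (a b c : Polynomial ℝ) (α ε : ℝ) (M : Polynomial ℝ) (K₁ K₂ : BiPoly) :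
    Polynomial ℝ :=
  (a.derivative.derivative - b.derivative) * M + b * M.derivative + a * M.derivative.derivative
    + 2 * c * M - Polynomial.C (Real.pi ^ 2 / 2 * α * ε)
    + a * (2 * onDiag (D₁ (K₁ - K₂)))

/-- Second component `K̂₁` of `Ω_c(M, K₁, K₂)`. -/
def OmegaC.K₁ (a b c : Polynomial ℝ) (K₁ : BiPoly) : BiPoly :=
  inX a * D₁ (D₁ K₁) + inX b * D₁ K₁ + inXi a * D₂ (D₂ K₁) + inXi b * D₂ K₁
    + (inX c + inXi c) * K₁

/-- Third component `K̂₂(x, ξ) = K̂₁(ξ, x)` of `Ω_c(M, K₁, K₂)`. -/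
def OmegaC.K₂ (a b c : Polynomial ℝ) (K₁ : BiPoly) : BiPoly := swapVars (OmegaC.K₁ a b c K₁)

/-- First component `M̂` of `Ω_s(M, K₁, K₂)`. -/
def OmegaS.M (a b c : Polynomial ℝ) (α ε : ℝ) (M : Polynomial ℝ) (K₁ K₂ : BiPoly) :
    Polynomial ℝ :=
  Polynomial.derivative (Polynomial.derivative (a * M) - b * M)
    + 2 * onDiag (D₁ (inX a * (K₁ - K₂)))
    + 2 * M * c - Polynomial.C (Real.pi ^ 2 / 2 * α * ε)

/-- Second component `K̂₁` of `Ω_s(M, K₁, K₂)`. -/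
def OmegaS.K₁ (a b c : Polynomial ℝ) (K₁ : BiPoly) : BiPoly :=
  D₁ (D₁ (inX a * K₁) - inX b * K₁) + D₂ (D₂ (inXi a * K₁) - inXi b * K₁)
    + (inX c + inXi c) * K₁

/-- Third component `K̂₂(x, ξ) = K̂₁(ξ, x)` of `Ω_s(M, K₁, K₂)`. -/
def OmegaS.K₂ (a b c : Polynomial ℝ) (K₁ : BiPoly) : BiPoly := swapVars (OmegaS.K₁ a b c K₁)

/-! ### Classical solutions

States are functions `w x t` of position `x ∈ [0, 1]` and time `t ≥ 0`; values elsewhere are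
irrelevant. Spatial derivatives are one-sided at the end points. -/

/-- Time derivative `w_t(x, t)`. -/
def dt (w : ℝ → ℝ → ℝ) (x t : ℝ) : ℝ := deriv (fun s => w x s) t

/-- Spatial derivative `w_x(x, t)` on `[0, 1]`. -/
def dx (w : ℝ → ℝ → ℝ) (x t : ℝ) : ℝ := derivWithin (fun y => w y t) (Set.Icc 0 1) x

/-- The `L₂(0,1)` norm of a square integrable function. -/
def l2norm (f : ℝ → ℝ) : ℝ := Real.sqrt (∫ x in (0 : ℝ)..1, f x ^ 2)

/-- `w` is of class `C^{1,2}` on time `(0, ∞)` and space `[0, 1]`. -/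
structure IsC12 (w : ℝ → ℝ → ℝ) : Prop where
  diff_t : ∀ x ∈ Set.Icc (0 : ℝ) 1, ∀ t > 0, DifferentiableAt ℝ (fun s => w x s) t
  diff_x : ∀ t > 0, DifferentiableOn ℝ (fun y => w y t) (Set.Icc 0 1)
  diff_xx : ∀ t > 0, DifferentiableOn ℝ (fun y => dx w y t) (Set.Icc 0 1)
  cont : ContinuousOn (fun p : ℝ × ℝ => w p.1 p.2) (Set.Icc 0 1 ×ˢ Set.Ioi 0)
  cont_t : ContinuousOn (fun p : ℝ × ℝ => dt w p.1 p.2) (Set.Icc 0 1 ×ˢ Set.Ioi 0)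
  cont_x : ContinuousOn (fun p : ℝ × ℝ => dx w p.1 p.2) (Set.Icc 0 1 ×ˢ Set.Ioi 0)
  cont_xx : ContinuousOn (fun p : ℝ × ℝ => dx (dx w) p.1 p.2) (Set.Icc 0 1 ×ˢ Set.Ioi 0)

/-- The initial state `w(·, 0)` lies in `L₂(0,1)` and is attained in `L₂(0,1)` as `t → 0+`. -/
structure AttainsInitial (w : ℝ → ℝ → ℝ) : Prop where
  memLp : MeasureTheory.MemLp (fun x => w x 0) 2
    (MeasureTheory.volume.restrict (Set.Icc (0 : ℝ) 1))
  tendsto : Filter.Tendsto (fun t => l2norm (fun x => w x t - w x 0))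
    (nhdsWithin 0 (Set.Ioi 0)) (nhds 0)

/-- `w` is a classical solution, with initial state in `L₂(0,1)`, of
`w_t = a w_xx + b w_x + c w`, `w(0,t) = 0`, `w_x(1,t) = u(t)`. -/
structure IsPlantSolution (a b c : Polynomial ℝ) (u : ℝ → ℝ) (w : ℝ → ℝ → ℝ) : Prop where
  regular : IsC12 w
  initial : AttainsInitial w
  pde : ∀ x ∈ Set.Icc (0 : ℝ) 1, ∀ t > 0,
    dt w x t = a.eval x * dx (dx w) x t + b.eval x * dx w x t + c.eval x * w x t
  bc_left : ∀ t > 0, w 0 t = 0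
  bc_right : ∀ t > 0, dx w 1 t = u t

/-- `w'` (the estimate `ŵ`) is a classical solution, with initial state in `L₂(0,1)`, of the
Luenberger observer with input `u`, measured output `v` and predicted output `v̂(t) = ŵ(1,t)`:
`ŵ_t = a ŵ_xx + b ŵ_x + c ŵ + L₁ (v̂ - v)`, `ŵ(0,t) = 0`, `ŵ_x(1,t) = u + L₂ (v̂ - v)`. -/
structure IsObserverSolution (a b c : Polynomial ℝ) (L₁ : ℝ → ℝ) (L₂ : ℝ) (u v : ℝ → ℝ)
    (w' : ℝ → ℝ → ℝ) : Prop where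
  regular : IsC12 w'
  initial : AttainsInitial w'
  pde : ∀ x ∈ Set.Icc (0 : ℝ) 1, ∀ t > 0,
    dt w' x t = a.eval x * dx (dx w') x t + b.eval x * dx w' x t + c.eval x * w' x t
      + L₁ x * (w' 1 t - v t)
  bc_left : ∀ t > 0, w' 0 t = 0
  bc_right : ∀ t > 0, dx w' 1 t = u t + L₂ * (w' 1 t - v t)

/-- The control law `u(t) = R₁ ŵ(1,t) + ∫₀¹ R₂(x) ŵ(x,t) dx`. -/
def feedback (R₁ : ℝ) (R₂ : ℝ → ℝ) (w' : ℝ → ℝ → ℝ) (t : ℝ) : ℝ :=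
  R₁ * w' 1 t + ∫ x in (0 : ℝ)..1, R₂ x * w' x t

end ParabolicSOS

end

open scoped ContDiff

noncomputable section

namespace ParabolicSOS

open intervalIntegral
open MeasureTheory (volume MemLp)

/-! ### Values of bivariate polynomials -/

/-! Write `A = a ∂² + b ∂ + c`, `T = op M K₁`, `S = op N S₁`. The error `e = ŵ - w` obeys `e_t = A e
+ L₁ e(1)`, `e(0) = 0`, `e_x(1) = L₂ e(1)`, independently of the control. The Lyapunov function is
`⟨ŵ, T⁻¹ ŵ⟩ + (C + 1) ⟨e, S e⟩`, where `C` measures how strongly `e(1)` disturbs the observer state.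

Membership in `Ξ` gives coercivity in `L₂` (`MemXi.coercive`): the form `⟨f, op f⟩` is the integral
of `vᵀ P v`, where `v` collects monomials times `f` and times its partial integrals. A coercive
operator of this shape is invertible on `C[0,1]` by the method of continuity (`isUnit_opCI`), and
preimages of smooth functions are smooth (`exists_smooth_preimage`). Hence `T⁻¹` exists, and smooth
gains can be defined by solving linear equations with `T` and `S`.

Integration by parts (`two_mul_integral_generator_mul_op` for `2⟨A f, S f⟩`,
`two_mul_integral_generator_op_mul` for `2⟨A T z, z⟩`) produces the form of `Ω` without its
constant, minus a weighted integral of the squared derivative, plus boundary terms at `x = 1`. The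
conditions `K₂(0,·) = 0` and `S₂(0,·) = 0` dispose of the end point `0`. The functions `L₁`, `R₂`
cancel the nonlocal boundary terms; the scalars `L₂`, `R₁` make the remaining quadratic boundary
term as negative as needed.

That freedom is exploited through `four_mul_integral_sq_le`: allowing a multiple of `f(1)²` on the
right raises the Wirtinger constant from the classical `π²/4` to `4`. The gain over the `π²/2 · αε`
built into `Ω` absorbs the injection term `L₁ e(1)`. The outcome is decay at rate `2δ` minus `e(1)²`
for the error form (`exists_observer_gains`), and decay at rate `2μ` up to `C e(1)²` for the
observer form (`exists_controller_gains`). The weight `C + 1` makes the sum decay. Since the initial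
state is attained only in `L₂`, the exponential estimate is proved on `[s, t]` with `s > 0`, and
then `s → 0`. -/

@[simp] lemma val_add (K L : BiPoly) (x y : ℝ) : (K + L).val x y = K.val x y + L.val x y := by
  simp [BiPoly.val]

@[simp] lemma val_sub (K L : BiPoly) (x y : ℝ) : (K - L).val x y = K.val x y - L.val x y := by
  simp [BiPoly.val]

@[simp] lemma val_neg (K : BiPoly) (x y : ℝ) : (-K).val x y = -K.val x y := by
  simp [BiPoly.val]

@[simp] lemma val_mul (K L : BiPoly) (x y : ℝ) : (K * L).val x y = K.val x y * L.val x y := by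
  simp [BiPoly.val]

@[simp] lemma val_C (r x y : ℝ) : BiPoly.val (MvPolynomial.C r) x y = r := by
  simp [BiPoly.val]

@[simp] lemma val_X_zero (x y : ℝ) : BiPoly.val (MvPolynomial.X 0) x y = x := by
  simp [BiPoly.val]

@[simp] lemma val_X_one (x y : ℝ) : BiPoly.val (MvPolynomial.X 1) x y = y := by
  simp [BiPoly.val]

@[simp] lemma val_inX (p : Polynomial ℝ) (x y : ℝ) : (inX p).val x y = p.eval x := by
  induction p using Polynomial.induction_on' with
  | add p q hp hq => simp_all [inX]
  | monomial n r => simp [inX, BiPoly.val, Polynomial.aeval_monomial]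

@[simp] lemma val_inXi (p : Polynomial ℝ) (x y : ℝ) : (inXi p).val x y = p.eval y := by
  induction p using Polynomial.induction_on' with
  | add p q hp hq => simp_all [inXi]
  | monomial n r => simp [inXi, BiPoly.val, Polynomial.aeval_monomial]

@[simp] lemma val_swapVars (K : BiPoly) (x y : ℝ) : (swapVars K).val x y = K.val y x := by
  simp only [swapVars, BiPoly.val, MvPolynomial.eval_rename]
  have h : (![x, y] ∘ ⇑(Equiv.swap (0 : Fin 2) 1)) = ![y, x] := by
    funext i
    fin_cases i <;> simp
  rw [h]

@[simp] lemma eval_onDiag (K : BiPoly) (x : ℝ) : (onDiag K).eval x = K.val x x := by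
  induction K using MvPolynomial.induction_on with
  | C r => simp [onDiag]
  | add p q hp hq => simp_all [onDiag]
  | mul_X p i hp =>
    have h : (![x, x] : Fin 2 → ℝ) i = x := by fin_cases i <;> rfl
    simp_all [onDiag, BiPoly.val]

lemma continuous_val {Y : Type*} [TopologicalSpace Y] (K : BiPoly) {f g : Y → ℝ}
    (hf : Continuous f) (hg : Continuous g) : Continuous fun y => K.val (f y) (g y) := by
  have h : Continuous fun y => (![f y, g y] : Fin 2 → ℝ) := by
    refine continuous_pi fun i => ?_
    fin_cases i
    · exact hf
    · exact hg
  have h2 := (MvPolynomial.continuous_eval K).comp h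
  simp only [Function.comp_def] at h2
  exact h2

attribute [fun_prop] continuous_val

lemma swapVars_add (K L : BiPoly) : swapVars (K + L) = swapVars K + swapVars L := by
  simp [swapVars]

lemma swapVars_sub (K L : BiPoly) : swapVars (K - L) = swapVars K - swapVars L := by
  simp [swapVars]

lemma swapVars_mul (K L : BiPoly) : swapVars (K * L) = swapVars K * swapVars L := by
  simp [swapVars]

lemma swapVars_swapVars (K : BiPoly) : swapVars (swapVars K) = K := by
  have h : (⇑(Equiv.swap (0 : Fin 2) 1) ∘ ⇑(Equiv.swap (0 : Fin 2) 1)) = id := by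
    funext i
    simp
  simp [swapVars, MvPolynomial.rename_rename, h]

lemma swapVars_inX (p : Polynomial ℝ) : swapVars (inX p) = inXi p := by
  simp only [swapVars, inX, inXi]
  rw [← Polynomial.aeval_algHom_apply]
  simp

lemma swapVars_D₁ (K : BiPoly) : swapVars (D₁ K) = D₂ (swapVars K) := by
  simp only [swapVars, D₁, D₂]
  have := MvPolynomial.pderiv_rename (R := ℝ) (Equiv.swap (0 : Fin 2) 1).injective 0 K
  simpa using this.symm

lemma D₁_add (K L : BiPoly) : D₁ (K + L) = D₁ K + D₁ L := by simp [D₁]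

lemma D₁_sub (K L : BiPoly) : D₁ (K - L) = D₁ K - D₁ L := by simp [D₁]

/-! ### Volterra integrals with polynomial kernel -/

/-- The lower triangular integral `∫₀ˣ K(x, ξ) f(ξ) dξ`. -/
def lo (K : BiPoly) (f : ℝ → ℝ) (x : ℝ) : ℝ := ∫ ξ in (0 : ℝ)..x, K.val x ξ * f ξ

/-- The upper triangular integral `∫ₓ¹ K(x, ξ) f(ξ) dξ`. -/
def up (K : BiPoly) (f : ℝ → ℝ) (x : ℝ) : ℝ := ∫ ξ in x..1, K.val x ξ * f ξ

section kernel

variable {f g : ℝ → ℝ}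

lemma lo_add (K L : BiPoly) (hf : Continuous f) (x : ℝ) :
    lo (K + L) f x = lo K f x + lo L f x := by
  simp only [lo, val_add, add_mul]
  exact integral_add (by apply Continuous.intervalIntegrable; fun_prop)
    (by apply Continuous.intervalIntegrable; fun_prop)

lemma up_add (K L : BiPoly) (hf : Continuous f) (x : ℝ) :
    up (K + L) f x = up K f x + up L f x := by
  simp only [up, val_add, add_mul]
  exact integral_add (by apply Continuous.intervalIntegrable; fun_prop)
    (by apply Continuous.intervalIntegrable; fun_prop)

lemma lo_sub (K L : BiPoly) (hf : Continuous f) (x : ℝ) :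
    lo (K - L) f x = lo K f x - lo L f x := by
  simp only [lo, val_sub, sub_mul]
  exact integral_sub (by apply Continuous.intervalIntegrable; fun_prop)
    (by apply Continuous.intervalIntegrable; fun_prop)

lemma up_sub (K L : BiPoly) (hf : Continuous f) (x : ℝ) :
    up (K - L) f x = up K f x - up L f x := by
  simp only [up, val_sub, sub_mul]
  exact integral_sub (by apply Continuous.intervalIntegrable; fun_prop)
    (by apply Continuous.intervalIntegrable; fun_prop)

lemma lo_inX_mul (p : Polynomial ℝ) (K : BiPoly) (f : ℝ → ℝ) (x : ℝ) :
    lo (inX p * K) f x = p.eval x * lo K f x := by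
  simp [lo, mul_assoc]

lemma up_inX_mul (p : Polynomial ℝ) (K : BiPoly) (f : ℝ → ℝ) (x : ℝ) :
    up (inX p * K) f x = p.eval x * up K f x := by
  simp [up, mul_assoc]

lemma lo_C_mul (r : ℝ) (K : BiPoly) (f : ℝ → ℝ) (x : ℝ) :
    lo (MvPolynomial.C r * K) f x = r * lo K f x := by
  simp [lo, mul_assoc]

lemma up_C_mul (r : ℝ) (K : BiPoly) (f : ℝ → ℝ) (x : ℝ) :
    up (MvPolynomial.C r * K) f x = r * up K f x := by
  simp [up, mul_assoc]

/-- Differentiation under the integral needs no analysis for polynomial kernels: a factor `x` leaves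
the integral and a factor `ξ` is absorbed into `f`. This is why the induction generalizes `f`. -/
lemma hasDerivAt_lo (K : BiPoly) (hf : Continuous f) (x : ℝ) :
    HasDerivAt (lo K f) (lo (D₁ K) f x + K.val x x * f x) x := by
  induction K using MvPolynomial.induction_on generalizing f with
  | C r =>
    have h1 : lo (MvPolynomial.C r) f = fun x => ∫ ξ in (0 : ℝ)..x, r * f ξ := by
      ext y; simp [lo]
    have h2 : lo (D₁ (MvPolynomial.C r)) f x = 0 := by simp [lo, D₁, BiPoly.val]
    rw [h1, h2, val_C, zero_add]
    exact ((continuous_const.mul hf).integral_hasStrictDerivAt 0 x).hasDerivAt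
  | add p q hp hq =>
    have h1 : lo (p + q) f = fun x => lo p f x + lo q f x := by ext y; exact lo_add p q hf y
    rw [h1, D₁_add, lo_add _ _ hf, val_add]
    refine ((hp hf).add (hq hf)).congr_deriv ?_
    ring
  | mul_X p i hp =>
    have hi : i = 0 ∨ i = 1 := by fin_cases i <;> simp
    rcases hi with rfl | rfl
    · have h1 : lo (p * MvPolynomial.X 0) f = fun x => x * lo p f x := by
        ext y
        simp only [lo, val_mul, val_X_zero, ← integral_const_mul]
        congr 1; ext ξ; ring
      have h2 : D₁ (p * MvPolynomial.X 0) = inX Polynomial.X * D₁ p + p := by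
        simp [D₁, inX]; ring
      rw [h1, h2, lo_add _ _ hf, lo_inX_mul]
      refine ((hasDerivAt_id x).mul (hp hf)).congr_deriv ?_
      simp; ring
    · have h1 : lo (p * MvPolynomial.X 1) f = lo p (fun ξ => ξ * f ξ) := by
        ext y
        simp only [lo, val_mul, val_X_one]
        congr 1; ext ξ; ring
      have h2 : lo (D₁ (p * MvPolynomial.X 1)) f x = lo (D₁ p) (fun ξ => ξ * f ξ) x := by
        have : D₁ (p * MvPolynomial.X 1) = D₁ p * MvPolynomial.X 1 := by
          simp [D₁, MvPolynomial.pderiv_X]; ring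
        simp only [lo, this, val_mul, val_X_one]
        congr 1; ext ξ; ring
      rw [h1, h2]
      refine (hp (f := fun ξ => ξ * f ξ) (by fun_prop)).congr_deriv ?_
      simp only [val_mul, val_X_one]; ring

lemma up_eq (K : BiPoly) (hf : Continuous f) (x : ℝ) :
    up K f x = (∫ ξ in (0 : ℝ)..1, K.val x ξ * f ξ) - lo K f x := by
  have h : ∀ u v, IntervalIntegrable (fun ξ => K.val x ξ * f ξ) MeasureTheory.volume u v :=
    fun u v => by apply Continuous.intervalIntegrable; fun_prop
  rw [eq_sub_iff_add_eq', lo, up, integral_add_adjacent_intervals (h _ _) (h _ _)]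

lemma hasDerivAt_full (K : BiPoly) (hf : Continuous f) (x : ℝ) :
    HasDerivAt (fun x => ∫ ξ in (0 : ℝ)..1, K.val x ξ * f ξ)
      (∫ ξ in (0 : ℝ)..1, (D₁ K).val x ξ * f ξ) x := by
  induction K using MvPolynomial.induction_on generalizing f with
  | C r => simpa [D₁, BiPoly.val] using hasDerivAt_const x _
  | add p q hp hq =>
    have h : ∀ (P : BiPoly) (y : ℝ),
        IntervalIntegrable (fun ξ => P.val y ξ * f ξ) MeasureTheory.volume 0 1 :=
      fun P y => by apply Continuous.intervalIntegrable; fun_prop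
    simp only [D₁_add, val_add, add_mul, integral_add (h _ _) (h _ _)]
    exact (hp hf).add (hq hf)
  | mul_X p i hp =>
    have hi : i = 0 ∨ i = 1 := by fin_cases i <;> simp
    rcases hi with rfl | rfl
    · have h : ∀ (P : BiPoly) (y : ℝ),
          IntervalIntegrable (fun ξ => P.val y ξ * f ξ) MeasureTheory.volume 0 1 :=
        fun P y => by apply Continuous.intervalIntegrable; fun_prop
      have h2 : D₁ (p * MvPolynomial.X 0) = MvPolynomial.X 0 * D₁ p + p := by
        simp [D₁]; ring
      have h1 : (fun x => ∫ ξ in (0 : ℝ)..1, BiPoly.val (p * MvPolynomial.X 0) x ξ * f ξ) =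
          fun x => x * ∫ ξ in (0 : ℝ)..1, BiPoly.val p x ξ * f ξ := by
        ext y
        simp only [val_mul, val_X_zero, ← integral_const_mul]
        congr 1; ext ξ; ring
      have h3 : (∫ ξ in (0 : ℝ)..1, (D₁ (p * MvPolynomial.X 0)).val x ξ * f ξ) =
          x * (∫ ξ in (0 : ℝ)..1, (D₁ p).val x ξ * f ξ) + ∫ ξ in (0 : ℝ)..1, BiPoly.val p x ξ * f ξ := by
        rw [← integral_const_mul, ← integral_add ((h _ _).const_mul _) (h _ _)]
        congr 1; ext ξ; rw [h2]; simp; ring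
      rw [h1, h3]
      refine ((hasDerivAt_id x).mul (hp hf)).congr_deriv ?_
      simp; ring
    · have h2 : D₁ (p * MvPolynomial.X 1) = D₁ p * MvPolynomial.X 1 := by
        simp [D₁, MvPolynomial.pderiv_X]; ring
      have := hp (f := fun ξ => ξ * f ξ) (by fun_prop)
      simp only [h2, val_mul, val_X_one]
      simpa only [mul_assoc] using this

/-- The integral from `x` to `1` is the full integral minus the lower one, so only the diagonal term
changes sign. -/
lemma hasDerivAt_up (K : BiPoly) (hf : Continuous f) (x : ℝ) :
    HasDerivAt (up K f) (up (D₁ K) f x - K.val x x * f x) x := by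
  have h1 : up K f = fun x => (∫ ξ in (0 : ℝ)..1, K.val x ξ * f ξ) - lo K f x := by
    ext y; exact up_eq K hf y
  rw [h1, up_eq _ hf]
  refine ((hasDerivAt_full K hf x).sub (hasDerivAt_lo K hf x)).congr_deriv ?_
  ring

lemma continuous_lo (K : BiPoly) (hf : Continuous f) : Continuous (lo K f) :=
  continuous_iff_continuousAt.2 fun x => (hasDerivAt_lo K hf x).continuousAt

lemma continuous_up (K : BiPoly) (hf : Continuous f) : Continuous (up K f) :=
  continuous_iff_continuousAt.2 fun x => (hasDerivAt_up K hf x).continuousAt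

lemma hasDerivAt_lower (hg : Continuous g) (x : ℝ) :
    HasDerivAt (fun x => ∫ ξ in (0 : ℝ)..x, g ξ) (g x) x :=
  (hg.integral_hasStrictDerivAt 0 x).hasDerivAt

lemma hasDerivAt_upper (hg : Continuous g) (x : ℝ) :
    HasDerivAt (fun x => ∫ ξ in x..(1 : ℝ), g ξ) (-g x) x := by
  refine (hg.integral_hasStrictDerivAt 1 x).hasDerivAt.neg.congr_of_eventuallyEq
    (Filter.Eventually.of_forall fun y => ?_)
  simp only [Pi.neg_apply]
  rw [integral_symm]

lemma continuous_lower (hg : Continuous g) : Continuous fun x => ∫ ξ in (0 : ℝ)..x, g ξ :=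
  continuous_iff_continuousAt.2 fun x => (hasDerivAt_lower hg x).continuousAt

lemma continuous_upper (hg : Continuous g) : Continuous fun x => ∫ ξ in x..(1 : ℝ), g ξ :=
  continuous_iff_continuousAt.2 fun x => (hasDerivAt_upper hg x).continuousAt

/-- Interchange of the order of integration over a triangle, for a product integrand. -/
lemma integral_mul_integral_triangle (hf : Continuous f) (hg : Continuous g) :
    ∫ x in (0 : ℝ)..1, g x * ∫ ξ in (0 : ℝ)..x, f ξ =
      ∫ ξ in (0 : ℝ)..1, f ξ * ∫ x in ξ..1, g x := by
  have hFc := continuous_lower hf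
  have hGc := continuous_upper hg
  -- In place of Fubini: the product `(∫₀ˣ f)(∫ₓ¹ g)` vanishes at both end points.
  have h := integral_eq_sub_of_hasDerivAt (a := 0) (b := 1) (fun x _ =>
    (hasDerivAt_lower hf x).mul (hasDerivAt_upper hg x)) (by apply Continuous.intervalIntegrable; fun_prop)
  rw [integral_add (by apply Continuous.intervalIntegrable; fun_prop)
    (by apply Continuous.intervalIntegrable; fun_prop)] at h
  simp only [Pi.mul_apply, integral_same, mul_zero, zero_mul, sub_zero, mul_neg,
    integral_neg] at h
  have h2 : ∫ x in (0 : ℝ)..1, (∫ ξ in (0 : ℝ)..x, f ξ) * g x =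
    ∫ x in (0 : ℝ)..1, g x * ∫ ξ in (0 : ℝ)..x, f ξ := by congr 1; ext; ring
  linarith

/-- The adjoint of a lower triangular operator is the upper triangular one with swapped kernel. By
the same induction on `K`, it reduces to the triangle identity for product integrands. -/
lemma integral_mul_lo (K : BiPoly) (hf : Continuous f) (hg : Continuous g) :
    ∫ x in (0 : ℝ)..1, g x * lo K f x = ∫ x in (0 : ℝ)..1, f x * up (swapVars K) g x := by
  induction K using MvPolynomial.induction_on generalizing f g with
  | C r =>
    have := integral_mul_integral_triangle (f := f) (g := fun x => r * g x) hf (by fun_prop)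
    simp only [lo, up, val_swapVars, val_C, integral_const_mul] at this ⊢
    rw [← this]
    congr 1; ext; ring
  | add p q hp hq =>
    simp only [swapVars_add, lo_add _ _ hf, up_add _ _ hg, mul_add]
    have := continuous_lo p hf
    have := continuous_lo q hf
    have := continuous_up (swapVars p) hg
    have := continuous_up (swapVars q) hg
    rw [integral_add, integral_add, hp hf hg, hq hf hg] <;>
      (apply Continuous.intervalIntegrable; fun_prop)
  | mul_X p i hp =>
    have hi : i = 0 ∨ i = 1 := by fin_cases i <;> simp
    rcases hi with rfl | rfl
    · have := hp (f := f) (g := fun x => x * g x) hf (by fun_prop)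
      simp only [lo, up, val_swapVars, val_mul, val_X_zero] at this ⊢
      convert this using 2
      · ext x
        simp only [mul_right_comm _ x, integral_mul_const]; ring
      · ext x
        congr 2; ext; ring
    · have := hp (f := fun x => x * f x) (g := g) (by fun_prop) hg
      simp only [lo, up, val_swapVars, val_mul, val_X_one] at this ⊢
      convert this using 2
      · ext x
        congr 2; ext; ring
      · ext x
        simp only [mul_right_comm _ x, integral_mul_const]; ring

end kernel

/-! ### The symmetric operator generated by a multiplier and a kernel -/

/-- The operator `f ↦ M f + ∫₀ˣ K(x, ξ) f(ξ) dξ + ∫ₓ¹ K(ξ, x) f(ξ) dξ`. -/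
def op (M : Polynomial ℝ) (K : BiPoly) (f : ℝ → ℝ) (x : ℝ) : ℝ :=
  M.eval x * f x + lo K f x + up (swapVars K) f x

/-- `f` is twice continuously differentiable with derivatives `f₁` and `f₂`. -/
structure HasC2 (f f₁ f₂ : ℝ → ℝ) : Prop where
  deriv₁ : ∀ x, HasDerivAt f (f₁ x) x
  deriv₂ : ∀ x, HasDerivAt f₁ (f₂ x) x
  cont₂ : Continuous f₂

lemma HasC2.cont {f f₁ f₂ : ℝ → ℝ} (h : HasC2 f f₁ f₂) : Continuous f :=
  continuous_iff_continuousAt.2 fun x => (h.deriv₁ x).continuousAt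

lemma HasC2.cont₁ {f f₁ f₂ : ℝ → ℝ} (h : HasC2 f f₁ f₂) : Continuous f₁ :=
  continuous_iff_continuousAt.2 fun x => (h.deriv₂ x).continuousAt

lemma intervalIntegrable_unit {g : ℝ → ℝ} (hg : Continuous g) :
    IntervalIntegrable g MeasureTheory.volume 0 1 := hg.intervalIntegrable _ _

section operator

variable {f g : ℝ → ℝ}

lemma continuous_op (M : Polynomial ℝ) (K : BiPoly) (hf : Continuous f) :
    Continuous (op M K f) := by
  have h1 := continuous_lo K hf
  have h2 := continuous_up (swapVars K) hf
  have h3 := M.continuous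
  exact ((h3.mul hf).add h1).add h2

lemma integral_mul_op_comm (M : Polynomial ℝ) (K : BiPoly) (hf : Continuous f)
    (hg : Continuous g) :
    ∫ x in (0 : ℝ)..1, g x * op M K f x = ∫ x in (0 : ℝ)..1, f x * op M K g x := by
  have h1 := continuous_lo K hf
  have h2 := continuous_up (swapVars K) hf
  have h1' := continuous_lo K hg
  have h2' := continuous_up (swapVars K) hg
  have h3 := M.continuous
  have e1 := integral_mul_lo K hf hg
  have e2 := integral_mul_lo K hg hf
  simp only [op, mul_add]
  rw [integral_add (intervalIntegrable_unit (by fun_prop)) (intervalIntegrable_unit (by fun_prop)),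
    integral_add (intervalIntegrable_unit (by fun_prop)) (intervalIntegrable_unit (by fun_prop)),
    integral_add (intervalIntegrable_unit (by fun_prop)) (intervalIntegrable_unit (by fun_prop)),
    integral_add (intervalIntegrable_unit (by fun_prop)) (intervalIntegrable_unit (by fun_prop)),
    e1, e2]
  have : ∫ x in (0 : ℝ)..1, g x * (M.eval x * f x) = ∫ x in (0 : ℝ)..1, f x * (M.eval x * g x) := by
    congr 1; ext; ring
  rw [this]; ring

lemma integral_mul_op_self (M : Polynomial ℝ) (K : BiPoly) (hf : Continuous f) :
    ∫ x in (0 : ℝ)..1, f x * op M K f x =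
      (∫ x in (0 : ℝ)..1, M.eval x * f x ^ 2) + 2 * ∫ x in (0 : ℝ)..1, f x * lo K f x := by
  have h1 := continuous_lo K hf
  have h2 := continuous_up (swapVars K) hf
  have h3 := M.continuous
  have e1 := integral_mul_lo K hf hf
  simp only [op, mul_add]
  rw [integral_add (intervalIntegrable_unit (by fun_prop)) (intervalIntegrable_unit (by fun_prop)),
    integral_add (intervalIntegrable_unit (by fun_prop)) (intervalIntegrable_unit (by fun_prop)),
    ← e1]
  have : ∫ x in (0 : ℝ)..1, f x * (M.eval x * f x) = ∫ x in (0 : ℝ)..1, M.eval x * f x ^ 2 := by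
    congr 1; ext; ring
  rw [this]; ring

/-- If the kernels agree on the diagonal, the triangular integrals can be differentiated under the
integral sign. -/
lemma hasDerivAt_lo_add_up (K L : BiPoly) (hKL : ∀ x, K.val x x = L.val x x) (hf : Continuous f)
    (x : ℝ) :
    HasDerivAt (fun x => lo K f x + up L f x) (lo (D₁ K) f x + up (D₁ L) f x) x := by
  refine ((hasDerivAt_lo K hf x).add (hasDerivAt_up L hf x)).congr_deriv ?_
  rw [hKL]; ring

/-- The jump of the kernel across the diagonal survives as a multiplier. Applied to first
derivatives of the kernels, this is the origin of the diagonal term in `Ω_c` and `Ω_s`. -/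
lemma hasDerivAt_lo_add_up_D₁ (K L : BiPoly) (hf : Continuous f) (x : ℝ) :
    HasDerivAt (fun x => lo K f x + up L f x)
      (lo (D₁ K) f x + up (D₁ L) f x + (K - L).val x x * f x) x := by
  refine ((hasDerivAt_lo K hf x).add (hasDerivAt_up L hf x)).congr_deriv ?_
  rw [val_sub]; ring

/-- Only the symmetric part of a kernel matters in a quadratic form, so the upper part can be folded
onto the lower triangle. This turns the one-sided action of the generator into the symmetric kernel
of `Ω`. -/
lemma integral_mul_lo_add_up (K L : BiPoly) (hf : Continuous f) :
    (∫ x in (0 : ℝ)..1, f x * lo K f x) + ∫ x in (0 : ℝ)..1, f x * up L f x =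
      ∫ x in (0 : ℝ)..1, f x * lo (K + swapVars L) f x := by
  have h1 := continuous_lo K hf
  have h2 := continuous_lo (swapVars L) hf
  have e := integral_mul_lo (swapVars L) hf hf
  rw [swapVars_swapVars] at e
  simp only [lo_add _ _ hf, mul_add]
  rw [integral_add (intervalIntegrable_unit (by fun_prop)) (intervalIntegrable_unit (by fun_prop)),
    e]

lemma up_at_one (K : BiPoly) (f : ℝ → ℝ) : up K f 1 = 0 := by simp [up]

lemma lo_at_zero (K : BiPoly) (f : ℝ → ℝ) : lo K f 0 = 0 := by simp [lo]

/-- The polynomial identity relating the symmetrised generator to `OmegaS.K₁`. -/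
lemma OmegaS_K₁_eq (a b c : Polynomial ℝ) (S : BiPoly) :
    (D₁ (D₁ (inX a * S) - inX b * S) + inX c * S) +
      swapVars (D₁ (D₁ (inX a * swapVars S) - inX b * swapVars S) + inX c * swapVars S) =
      OmegaS.K₁ a b c S := by
  simp only [swapVars_add, swapVars_sub, swapVars_mul, swapVars_D₁, swapVars_inX,
    swapVars_swapVars, OmegaS.K₁]
  ring

lemma OmegaC_K₁_eq (a b c : Polynomial ℝ) (K : BiPoly) :
    (inX a * D₁ (D₁ K) + inX b * D₁ K + inX c * K) +
      swapVars (inX a * D₁ (D₁ (swapVars K)) + inX b * D₁ (swapVars K) + inX c * swapVars K) =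
      OmegaC.K₁ a b c K := by
  simp only [swapVars_add, swapVars_mul, swapVars_D₁, swapVars_inX,
    swapVars_swapVars, OmegaC.K₁]
  ring

/-- Integration by parts for `⟨A f, S f⟩` with `A = a ∂² + b ∂ + c`. -/
lemma two_mul_integral_generator_mul_op (a b c N : Polynomial ℝ) (S : BiPoly) {f f₁ f₂ : ℝ → ℝ}
    (h : HasC2 f f₁ f₂) (h0 : f 0 = 0) (hS : ∀ x, (swapVars S).val 0 x = 0) :
    2 * ∫ x in (0 : ℝ)..1, (a.eval x * f₂ x + b.eval x * f₁ x + c.eval x * f x) * op N S f x =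
      (∫ x in (0 : ℝ)..1, f x * op (Polynomial.derivative (Polynomial.derivative (a * N) - b * N)
        + 2 * onDiag (D₁ (inX a * (S - swapVars S))) + 2 * N * c) (OmegaS.K₁ a b c S) f x)
      - 2 * (∫ x in (0 : ℝ)..1, a.eval x * N.eval x * f₁ x ^ 2)
      + (2 * a.eval 1 * f₁ 1 * op N S f 1
        + (b * N - Polynomial.derivative (a * N)).eval 1 * f 1 ^ 2
        + 2 * f 1 * (b.eval 1 * lo S f 1 - lo (D₁ (inX a * S)) f 1)) := by
  have hf := h.cont
  have hf₁ := h.cont₁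
  have hf₂ := h.cont₂
  set S' := swapVars S with hS'
  set G : BiPoly := D₁ (D₁ (inX a * S) - inX b * S) + inX c * S with hG
  set G' : BiPoly := D₁ (D₁ (inX a * S') - inX b * S') + inX c * S' with hG'
  set A₁ : ℝ → ℝ := fun x => lo (D₁ (inX a * S)) f x + up (D₁ (inX a * S')) f x with hA₁
  set A₂ : ℝ → ℝ := fun x => lo (D₁ (D₁ (inX a * S))) f x + up (D₁ (D₁ (inX a * S'))) f x
    + (D₁ (inX a * S) - D₁ (inX a * S')).val x x * f x with hA₂
  set B₁ : ℝ → ℝ := fun x => lo (D₁ (inX b * S)) f x + up (D₁ (inX b * S')) f x with hB₁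
  have dA : ∀ x, HasDerivAt (fun x => lo (inX a * S) f x + up (inX a * S') f x) (A₁ x) x :=
    hasDerivAt_lo_add_up _ _ (by simp [hS']) hf
  have dA₁ : ∀ x, HasDerivAt A₁ (A₂ x) x := hasDerivAt_lo_add_up_D₁ _ _ hf
  have dB : ∀ x, HasDerivAt (fun x => lo (inX b * S) f x + up (inX b * S') f x) (B₁ x) x :=
    hasDerivAt_lo_add_up _ _ (by simp [hS']) hf
  set D : ℝ → ℝ := fun x => (Polynomial.derivative (Polynomial.derivative (a * N) - b * N)
        + 2 * onDiag (D₁ (inX a * (S - S'))) + 2 * N * c).eval x with hD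
  have hDc : Continuous D := Polynomial.continuous _
  have hac := a.continuous
  have hNc := N.continuous
  have hGc := continuous_lo G hf
  have hGc' := continuous_up G' hf
  -- With `q` the kernel part of `op N S f`, the primitive is `2 f₁ · a (N f + q) + (bN - (aN)') f²
  -- + 2 f (b q - (a q)')`; it carries all integrations by parts at once.
  have key : ∀ x, HasDerivAt (fun x => 2 * (f₁ x * ((a * N).eval x * f x
        + (lo (inX a * S) f x + up (inX a * S') f x)))
        + (b * N - Polynomial.derivative (a * N)).eval x * f x ^ 2
        + 2 * (f x * ((lo (inX b * S) f x + up (inX b * S') f x) - A₁ x)))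
      (2 * ((a.eval x * f₂ x + b.eval x * f₁ x + c.eval x * f x) * op N S f x)
        + 2 * (a.eval x * N.eval x * f₁ x ^ 2) - D x * f x ^ 2
        - 2 * (f x * lo G f x) - 2 * (f x * up G' f x)) x := by
    intro x
    refine ((((h.deriv₂ x).mul ((((a * N).hasDerivAt x).mul (h.deriv₁ x)).add (dA x))).const_mul
      2).add (((b * N - Polynomial.derivative (a * N)).hasDerivAt x).mul ((h.deriv₁ x).pow 2))
      |>.add (((h.deriv₁ x).mul ((dB x).sub (dA₁ x))).const_mul 2)).congr_deriv ?_
    simp only [Pi.add_apply, Pi.mul_apply, Pi.sub_apply, Pi.pow_apply, hA₁, hA₂, hB₁, hS', hG, hG',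
      hD, op, lo_inX_mul, up_inX_mul, lo_add _ _ hf, up_add _ _ hf,
      D₁_sub, lo_sub _ _ hf, up_sub _ _ hf, Polynomial.eval_add, Polynomial.eval_sub,
      Polynomial.eval_mul, Polynomial.derivative_sub, eval_onDiag, mul_sub, val_sub,
      Polynomial.eval_ofNat]
    push_cast
    ring
  have hcont : Continuous (fun x => 2 * ((a.eval x * f₂ x + b.eval x * f₁ x + c.eval x * f x)
      * op N S f x)) := by
    have := continuous_op N S hf
    have := b.continuous
    have := c.continuous
    fun_prop
  have hftc := integral_eq_sub_of_hasDerivAt (a := 0) (b := 1) (fun x _ => key x)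
    (intervalIntegrable_unit (by fun_prop))
  rw [integral_sub (intervalIntegrable_unit (by fun_prop)) (intervalIntegrable_unit (by fun_prop)),
    integral_sub (intervalIntegrable_unit (by fun_prop)) (intervalIntegrable_unit (by fun_prop)),
    integral_sub (intervalIntegrable_unit (by fun_prop)) (intervalIntegrable_unit (by fun_prop)),
    integral_add (intervalIntegrable_unit (by fun_prop)) (intervalIntegrable_unit (by fun_prop)),
    integral_const_mul, integral_const_mul, integral_const_mul, integral_const_mul] at hftc
  have hsym := integral_mul_lo_add_up G G' hf
  rw [hG, hG', hS', OmegaS_K₁_eq, ← hS', ← hG, ← hG'] at hsym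
  rw [integral_mul_op_self _ _ hf, ← hsym]
  -- Nothing is known about `f₁ 0`; its coefficient vanishes because `f 0 = 0` and the swapped
  -- kernel is zero on `x = 0`.
  have hq0 : up S' f 0 = 0 := by simp [up, hS]
  simp only [hA₁, op, lo_inX_mul, up_inX_mul, up_at_one, lo_at_zero, h0, hq0,
    Polynomial.eval_mul] at hftc ⊢
  linear_combination hftc

/-- Integration by parts for `⟨A P z, z⟩` with `A = a ∂² + b ∂ + c`. -/
lemma two_mul_integral_generator_op_mul (a b c M : Polynomial ℝ) (K : BiPoly)
    {f f₁ f₂ z z₁ z₂ : ℝ → ℝ} (h : HasC2 f f₁ f₂) (hz : HasC2 z z₁ z₂)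
    (hfz : ∀ x ∈ Set.Icc (0 : ℝ) 1, op M K z x = f x) (h0 : z 0 = 0) :
    2 * ∫ x in (0 : ℝ)..1, (a.eval x * f₂ x + b.eval x * f₁ x + c.eval x * f x) * z x =
      (∫ x in (0 : ℝ)..1, z x * op ((a.derivative.derivative - b.derivative) * M
        + b * M.derivative + a * M.derivative.derivative + 2 * c * M
        + a * (2 * onDiag (D₁ (K - swapVars K)))) (OmegaC.K₁ a b c K) z x)
      - 2 * (∫ x in (0 : ℝ)..1, a.eval x * M.eval x * z₁ x ^ 2)
      + (2 * a.eval 1 * z 1 * (f₁ 1 - lo (D₁ K) z 1)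
        + (b * M - Polynomial.derivative (a * M)).eval 1 * z 1 ^ 2) := by
  have hzc := hz.cont
  have hz₁ := hz.cont₁
  have hz₂ := hz.cont₂
  have hf := h.cont
  have hf₁ := h.cont₁
  have hf₂ := h.cont₂
  set K' := swapVars K with hK'
  set G : BiPoly := inX a * D₁ (D₁ K) + inX b * D₁ K + inX c * K with hG
  set G' : BiPoly := inX a * D₁ (D₁ K') + inX b * D₁ K' + inX c * K' with hG'
  set q₁ : ℝ → ℝ := fun x => lo (D₁ K) z x + up (D₁ K') z x with hq₁
  set q₂ : ℝ → ℝ := fun x => lo (D₁ (D₁ K)) z x + up (D₁ (D₁ K')) z x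
    + (D₁ K - D₁ K').val x x * z x with hq₂
  have dq : ∀ x, HasDerivAt (fun x => lo K z x + up K' z x) (q₁ x) x :=
    hasDerivAt_lo_add_up _ _ (by simp [hK']) hzc
  have dq₁ : ∀ x, HasDerivAt q₁ (q₂ x) x := hasDerivAt_lo_add_up_D₁ _ _ hzc
  set w₁ : ℝ → ℝ := fun x => M.derivative.eval x * z x + M.eval x * z₁ x + q₁ x with hw₁
  set w₂ : ℝ → ℝ := fun x => M.derivative.derivative.eval x * z x + 2 * M.derivative.eval x * z₁ x
    + M.eval x * z₂ x + q₂ x with hw₂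
  have dw : ∀ x, HasDerivAt (op M K z) (w₁ x) x := fun x => by
    have := ((M.hasDerivAt x).mul (hz.deriv₁ x)).add (dq x)
    refine HasDerivAt.congr_of_eventuallyEq this (Filter.Eventually.of_forall fun y => ?_)
    simp only [op, Pi.add_apply, Pi.mul_apply, hK']; ring
  have dw₁ : ∀ x, HasDerivAt w₁ (w₂ x) x := fun x => by
    refine ((((M.derivative.hasDerivAt x).mul (hz.deriv₁ x)).add
      ((M.hasDerivAt x).mul (hz.deriv₂ x))).add (dq₁ x)).congr_deriv ?_
    simp only [hw₂]; ring
  -- `f` and `op M K z` agree only on `[0, 1]`, so their derivatives are compared as derivatives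
  -- within that interval, where they are unique.
  have ef₁ : ∀ x ∈ Set.Icc (0 : ℝ) 1, w₁ x = f₁ x := fun x hx =>
    (uniqueDiffOn_Icc zero_lt_one x hx).eq_deriv _
      ((dw x).hasDerivWithinAt.congr (fun y hy => (hfz y hy).symm) (hfz x hx).symm)
      (h.deriv₁ x).hasDerivWithinAt
  have ef₂ : ∀ x ∈ Set.Icc (0 : ℝ) 1, w₂ x = f₂ x := fun x hx =>
    (uniqueDiffOn_Icc zero_lt_one x hx).eq_deriv _
      ((dw₁ x).hasDerivWithinAt.congr (fun y hy => (ef₁ y hy).symm) (ef₁ x hx).symm)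
      (h.deriv₂ x).hasDerivWithinAt
  set D : ℝ → ℝ := fun x => ((a.derivative.derivative - b.derivative) * M
        + b * M.derivative + a * M.derivative.derivative + 2 * c * M
        + a * (2 * onDiag (D₁ (K - K')))).eval x with hD
  have hDc : Continuous D := Polynomial.continuous _
  have hac := a.continuous
  have hbc := b.continuous
  have hcc := c.continuous
  have hMc := M.continuous
  have hGc := continuous_lo G hzc
  have hGc' := continuous_up G' hzc
  -- Only the multiplier part `M z` of `f` is integrated by parts. Derivatives of the kernel part
  -- are again kernel operators on `z`, plus the diagonal jump.
  have key : ∀ x ∈ Set.uIcc (0 : ℝ) 1, HasDerivAt (fun x => 2 * ((a * M).eval x * (z x * z₁ x))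
        + (b * M - Polynomial.derivative (a * M) + 2 * a * M.derivative).eval x * z x ^ 2)
      (2 * ((a.eval x * f₂ x + b.eval x * f₁ x + c.eval x * f x) * z x)
        + 2 * (a.eval x * M.eval x * z₁ x ^ 2) - D x * z x ^ 2
        - 2 * (z x * lo G z x) - 2 * (z x * up G' z x)) x := by
    intro x hx
    rw [Set.uIcc_of_le zero_le_one] at hx
    refine (((((a * M).hasDerivAt x).mul ((hz.deriv₁ x).mul (hz.deriv₂ x))).const_mul 2).add
      (((b * M - Polynomial.derivative (a * M) + 2 * a * M.derivative).hasDerivAt x).mul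
        ((hz.deriv₁ x).pow 2))).congr_deriv ?_
    rw [← ef₁ x hx, ← ef₂ x hx, ← hfz x hx]
    simp only [Pi.mul_apply, Pi.pow_apply, hw₁, hw₂, hq₁, hq₂, hK',
      hG, hG', hD, op, lo_inX_mul, up_inX_mul, lo_add _ _ hzc,
      up_add _ _ hzc, D₁_sub, Polynomial.eval_add, Polynomial.eval_sub,
      Polynomial.eval_mul, Polynomial.derivative_sub, Polynomial.derivative_add,
      Polynomial.derivative_mul, eval_onDiag, val_sub, Polynomial.eval_ofNat,
      Polynomial.derivative_ofNat, Polynomial.eval_zero]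
    push_cast
    ring
  have hftc := integral_eq_sub_of_hasDerivAt (a := 0) (b := 1) key
    (intervalIntegrable_unit (by fun_prop))
  rw [integral_sub (intervalIntegrable_unit (by fun_prop)) (intervalIntegrable_unit (by fun_prop)),
    integral_sub (intervalIntegrable_unit (by fun_prop)) (intervalIntegrable_unit (by fun_prop)),
    integral_sub (intervalIntegrable_unit (by fun_prop)) (intervalIntegrable_unit (by fun_prop)),
    integral_add (intervalIntegrable_unit (by fun_prop)) (intervalIntegrable_unit (by fun_prop)),
    integral_const_mul, integral_const_mul, integral_const_mul, integral_const_mul] at hftc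
  have hsym := integral_mul_lo_add_up G G' hzc
  rw [hG, hG', hK', OmegaC_K₁_eq, ← hK', ← hG, ← hG'] at hsym
  rw [integral_mul_op_self _ _ hzc, ← hsym]
  have e1 := ef₁ 1 (by simp)
  simp only [hw₁, hq₁, up_at_one] at e1
  rw [← e1]
  simp only [hD, h0, Polynomial.eval_mul, Polynomial.eval_add, Polynomial.eval_sub,
    Polynomial.eval_ofNat] at hftc ⊢
  linear_combination hftc

end operator

/-- A Wirtinger inequality with boundary term. -/
lemma four_mul_integral_sq_le {f f₁ : ℝ → ℝ} (h : ∀ x, HasDerivAt f (f₁ x) x)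
    (hf₁ : Continuous f₁) (h0 : f 0 = 0) :
    4 * ∫ x in (0 : ℝ)..1, f x ^ 2 ≤
      (∫ x in (0 : ℝ)..1, f₁ x ^ 2) + 2 * Real.tan 1 * f 1 ^ 2 := by
  have hf : Continuous f := continuous_iff_continuousAt.2 fun x => (h x).continuousAt
  have hcos : ∀ x ∈ Set.uIcc (0 : ℝ) 1, 0 < Real.cos (2 * x - 1) := by
    intro x hx
    rw [Set.uIcc_of_le zero_le_one] at hx
    have := Real.pi_gt_three
    exact Real.cos_pos_of_mem_Ioo ⟨by linarith [hx.1], by linarith [hx.2]⟩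
  have htan : ContinuousOn (fun x => Real.tan (2 * x - 1)) (Set.uIcc (0 : ℝ) 1) := fun x hx =>
    ((Real.continuousAt_tan.2 (hcos x hx).ne').comp
      (f := fun x => 2 * x - 1) (by fun_prop)).continuousWithinAt
  -- The function `φ = 2 tan(2x - 1)` solves the Riccati equation `φ' = φ² + 4`, which completes the
  -- square in `(φ f²)'`. It is finite on `[0, 1]` because `1 < π/2`.
  have key : ∀ x ∈ Set.uIcc (0 : ℝ) 1, HasDerivAt (fun x => 2 * Real.tan (2 * x - 1) * f x ^ 2)
      ((f₁ x + 2 * Real.tan (2 * x - 1) * f x) ^ 2 - f₁ x ^ 2 + 4 * f x ^ 2) x := by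
    intro x hx
    have h1 := (Real.hasDerivAt_tan (hcos x hx).ne').comp x
      (((hasDerivAt_id x).const_mul 2).sub_const 1)
    refine ((h1.const_mul 2).mul ((h x).pow 2)).congr_deriv ?_
    simp only [Function.comp_def, id_eq, Pi.pow_apply, Real.tan_eq_sin_div_cos]
    have := hcos x hx
    field_simp
    have hs := Real.sin_sq_add_cos_sq (2 * x - 1)
    push_cast
    linear_combination (-4 * f x ^ 2) * hs
  have i1 : IntervalIntegrable (fun x => (f₁ x + 2 * Real.tan (2 * x - 1) * f x) ^ 2)
      MeasureTheory.volume 0 1 := by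
    apply ContinuousOn.intervalIntegrable
    fun_prop
  have i2 : IntervalIntegrable (fun x => f₁ x ^ 2) MeasureTheory.volume 0 1 :=
    intervalIntegrable_unit (by fun_prop)
  have i3 : IntervalIntegrable (fun x => 4 * f x ^ 2) MeasureTheory.volume 0 1 :=
    intervalIntegrable_unit (by fun_prop)
  have hftc := integral_eq_sub_of_hasDerivAt key ((i1.sub i2).add i3)
  rw [integral_add (i1.sub i2) i3, integral_sub i1 i2, integral_const_mul] at hftc
  have hpos : 0 ≤ ∫ x in (0 : ℝ)..1, (f₁ x + 2 * Real.tan (2 * x - 1) * f x) ^ 2 :=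
    integral_nonneg zero_le_one fun x _ => sq_nonneg _
  norm_num [h0] at hftc
  linarith

section cone

open Matrix

/-! ### Positivity of the forms in the cone `Ξ` -/

/-! ### Reducing products of partial integrals to triangular integrals -/

section primitives

variable {m g h : ℝ → ℝ}

/-- The product `(∫₀ˣ m)(∫ₓ¹ g)(∫ₓ¹ h)` vanishes at `0` and at `1`; its derivative has three terms,
and the two without `m` are put in triangular form. -/
lemma integral_mul_upper_mul_upper (hm : Continuous m) (hg : Continuous g) (hh : Continuous h) :
    ∫ x in (0 : ℝ)..1, m x * ((∫ ξ in x..1, g ξ) * ∫ ξ in x..1, h ξ) =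
      (∫ x in (0 : ℝ)..1, g x * ∫ ξ in (0 : ℝ)..x, (∫ η in (0 : ℝ)..ξ, m η) * h ξ) +
      ∫ x in (0 : ℝ)..1, h x * ∫ ξ in (0 : ℝ)..x, (∫ η in (0 : ℝ)..ξ, m η) * g ξ := by
  have c1 := continuous_lower hm
  have c2 := continuous_upper hg
  have c3 := continuous_upper hh
  rw [integral_mul_integral_triangle (by fun_prop) hg,
    integral_mul_integral_triangle (by fun_prop) hh]
  have hftc := integral_eq_sub_of_hasDerivAt (a := 0) (b := 1)
    (fun x _ => ((hasDerivAt_lower hm x).mul ((hasDerivAt_upper hg x).mul (hasDerivAt_upper hh x))))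
    (intervalIntegrable_unit (by fun_prop))
  simp only [Pi.mul_apply, integral_same, mul_zero, zero_mul, sub_zero] at hftc
  rw [integral_add (intervalIntegrable_unit (by fun_prop))
    (intervalIntegrable_unit (by fun_prop))] at hftc
  rw [← integral_add (intervalIntegrable_unit (by fun_prop)) (intervalIntegrable_unit (by fun_prop)),
    eq_neg_of_add_eq_zero_left hftc, ← integral_neg]
  congr 1; ext; ring

/-- The mirror image, from the product `(∫ₓ¹ m)(∫₀ˣ g)(∫₀ˣ h)`. -/
lemma integral_mul_lower_mul_lower (hm : Continuous m) (hg : Continuous g) (hh : Continuous h) :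
    ∫ x in (0 : ℝ)..1, m x * ((∫ ξ in (0 : ℝ)..x, g ξ) * ∫ ξ in (0 : ℝ)..x, h ξ) =
      (∫ x in (0 : ℝ)..1, (g x * ∫ η in x..1, m η) * ∫ ξ in (0 : ℝ)..x, h ξ) +
      ∫ x in (0 : ℝ)..1, (h x * ∫ η in x..1, m η) * ∫ ξ in (0 : ℝ)..x, g ξ := by
  have c1 := continuous_upper hm
  have c2 := continuous_lower hg
  have c3 := continuous_lower hh
  have hftc := integral_eq_sub_of_hasDerivAt (a := 0) (b := 1)
    (fun x _ => ((hasDerivAt_upper hm x).mul ((hasDerivAt_lower hg x).mul (hasDerivAt_lower hh x))))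
    (intervalIntegrable_unit (by fun_prop))
  simp only [Pi.mul_apply, integral_same, mul_zero, zero_mul, sub_zero] at hftc
  rw [integral_add (intervalIntegrable_unit (by fun_prop))
    (intervalIntegrable_unit (by fun_prop))] at hftc
  rw [← integral_add (intervalIntegrable_unit (by fun_prop)) (intervalIntegrable_unit (by fun_prop))]
  have e : ∫ x in (0 : ℝ)..1, (-m x) * ((∫ ξ in (0 : ℝ)..x, g ξ) * ∫ ξ in (0 : ℝ)..x, h ξ) =
      -∫ x in (0 : ℝ)..1, m x * ((∫ ξ in (0 : ℝ)..x, g ξ) * ∫ ξ in (0 : ℝ)..x, h ξ) := by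
    rw [← integral_neg]; congr 1; ext; ring
  rw [e, neg_add_eq_zero] at hftc
  rw [hftc]
  congr 1; ext; ring

/-- The inner integral on the right is a primitive of `m(x) ∫₀ˣ h` that vanishes at `0`; one
integration by parts against `∫ₓ¹ g` suffices. -/
lemma integral_mul_upper_mul_lower (hm : Continuous m) (hg : Continuous g) (hh : Continuous h) :
    ∫ x in (0 : ℝ)..1, m x * ((∫ ξ in x..1, g ξ) * ∫ ξ in (0 : ℝ)..x, h ξ) =
      ∫ x in (0 : ℝ)..1, g x * ∫ ξ in (0 : ℝ)..x, (∫ η in ξ..x, m η) * h ξ := by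
  have c1 := continuous_lower hm
  have c2 := continuous_upper hg
  have c3 := continuous_lower hh
  have hc : Continuous fun ξ => (∫ η in (0 : ℝ)..ξ, m η) * h ξ := by fun_prop
  have c4 := continuous_lower hc
  have e : ∀ x, ∫ ξ in (0 : ℝ)..x, (∫ η in ξ..x, m η) * h ξ =
      (∫ η in (0 : ℝ)..x, m η) * (∫ ξ in (0 : ℝ)..x, h ξ)
        - ∫ ξ in (0 : ℝ)..x, (∫ η in (0 : ℝ)..ξ, m η) * h ξ := by
    intro x
    rw [← integral_const_mul, ← integral_sub (by apply Continuous.intervalIntegrable; fun_prop)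
      (hc.intervalIntegrable _ _)]
    congr 1
    ext ξ
    rw [← sub_mul, integral_interval_sub_left (hm.intervalIntegrable _ _)
      (hm.intervalIntegrable _ _)]
  simp only [e]
  have hftc := integral_eq_sub_of_hasDerivAt (a := 0) (b := 1)
    (fun x _ => (hasDerivAt_upper hg x).mul
      (((hasDerivAt_lower hm x).mul (hasDerivAt_lower hh x)).sub (hasDerivAt_lower hc x)))
    (intervalIntegrable_unit (by
      simp only [Pi.sub_apply, Pi.mul_apply]
      fun_prop))
  simp only [Pi.sub_apply, Pi.mul_apply, integral_same, mul_zero, zero_mul, sub_zero] at hftc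
  rw [integral_add (intervalIntegrable_unit (by fun_prop))
    (intervalIntegrable_unit (by fun_prop))] at hftc
  have e2 : ∫ x in (0 : ℝ)..1, (-g x) * ((∫ η in (0 : ℝ)..x, m η) * (∫ ξ in (0 : ℝ)..x, h ξ)
        - ∫ ξ in (0 : ℝ)..x, (∫ η in (0 : ℝ)..ξ, m η) * h ξ) =
      -∫ x in (0 : ℝ)..1, g x * ((∫ η in (0 : ℝ)..x, m η) * (∫ ξ in (0 : ℝ)..x, h ξ)
        - ∫ ξ in (0 : ℝ)..x, (∫ η in (0 : ℝ)..ξ, m η) * h ξ) := by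
    rw [← integral_neg]; congr 1; ext; ring
  rw [e2, neg_add_eq_zero] at hftc
  rw [hftc]
  congr 1; ext; ring

end primitives

/-! ### Triangular quadratic forms and coercivity -/

/-- The quadratic form `∫₀¹ f(x) ∫₀ˣ k(x, ξ) f(ξ) dξ dx` of a kernel on the triangle `ξ ≤ x`. -/
def tri (f : ℝ → ℝ) (k : ℝ → ℝ → ℝ) : ℝ :=
  ∫ x in (0 : ℝ)..1, f x * ∫ ξ in (0 : ℝ)..x, k x ξ * f ξ

section tri

variable {f : ℝ → ℝ}

lemma continuous_tri_inner {k : ℝ → ℝ → ℝ} (hf : Continuous f)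
    (hk : Continuous (Function.uncurry k)) :
    Continuous fun x => f x * ∫ ξ in (0 : ℝ)..x, k x ξ * f ξ := by
  refine hf.mul ?_
  refine continuous_parametric_intervalIntegral_of_continuous
    (f := fun x ξ => k x ξ * f ξ) ?_ continuous_id
  exact hk.mul (hf.comp continuous_snd)

lemma tri_add {k l : ℝ → ℝ → ℝ} (hf : Continuous f) (hk : Continuous (Function.uncurry k))
    (hl : Continuous (Function.uncurry l)) :
    tri f (fun x ξ => k x ξ + l x ξ) = tri f k + tri f l := by
  have hk' : ∀ x, Continuous fun ξ => k x ξ := fun x =>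
    hk.comp (by fun_prop : Continuous fun ξ => (x, ξ))
  have hl' : ∀ x, Continuous fun ξ => l x ξ := fun x =>
    hl.comp (by fun_prop : Continuous fun ξ => (x, ξ))
  simp only [tri]
  rw [← integral_add (intervalIntegrable_unit (continuous_tri_inner hf hk))
    (intervalIntegrable_unit (continuous_tri_inner hf hl))]
  congr 1
  ext x
  simp only [add_mul]
  rw [← mul_add, integral_add (by apply Continuous.intervalIntegrable; fun_prop)
    (by apply Continuous.intervalIntegrable; fun_prop)]

lemma tri_const_mul (r : ℝ) (k : ℝ → ℝ → ℝ) :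
    tri f (fun x ξ => r * k x ξ) = r * tri f k := by
  simp only [tri, mul_assoc, integral_const_mul, mul_left_comm _ r]

lemma tri_sum {ι : Type*} (s : Finset ι) {k : ι → ℝ → ℝ → ℝ} (hf : Continuous f)
    (hk : ∀ i, Continuous (Function.uncurry (k i))) :
    tri f (fun x ξ => ∑ i ∈ s, k i x ξ) = ∑ i ∈ s, tri f (k i) := by
  classical
  induction s using Finset.induction_on with
  | empty => simp [tri]
  | insert i s his ih =>
    simp only [Finset.sum_insert his]
    rw [tri_add hf (hk i), ih]
    simp only [Function.uncurry_def] at hk ⊢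
    fun_prop

lemma tri_sum_sum {ι κ : Type*} [Fintype ι] [Fintype κ] (r : ι → κ → ℝ) {k : ι → κ → ℝ → ℝ → ℝ}
    (hf : Continuous f) (hk : ∀ i j, Continuous (Function.uncurry (k i j))) :
    tri f (fun x ξ => ∑ i, ∑ j, r i j * k i j x ξ) = ∑ i, ∑ j, r i j * tri f (k i j) := by
  rw [tri_sum (k := fun i x ξ => ∑ j, r i j * k i j x ξ) _ hf]
  · refine Finset.sum_congr rfl fun i _ => ?_
    rw [tri_sum (k := fun j x ξ => r i j * k i j x ξ) _ hf]
    · exact Finset.sum_congr rfl fun j _ => tri_const_mul _ _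
    · intro j
      exact continuous_const.mul (hk i j)
  · intro i
    exact continuous_finsetSum _ fun j _ => continuous_const.mul (hk i j)

end tri

lemma dotProduct_mulVec_eq_sum {ι κ : Type*} [Fintype ι] [Fintype κ] (Q : Matrix ι κ ℝ)
    (u : ι → ℝ) (v : κ → ℝ) : u ⬝ᵥ (Q *ᵥ v) = ∑ i, ∑ j, Q i j * (u i * v j) := by
  simp only [dotProduct, mulVec, Finset.mul_sum]
  exact Finset.sum_congr rfl fun i _ => Finset.sum_congr rfl fun j _ => by ring

lemma integral_sum_sum {ι κ : Type*} [Fintype ι] [Fintype κ] (r : ι → κ → ℝ)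
    {k : ι → κ → ℝ → ℝ} (hk : ∀ i j, Continuous (k i j)) (a b : ℝ) :
    ∫ x in a..b, ∑ i, ∑ j, r i j * k i j x = ∑ i, ∑ j, r i j * ∫ x in a..b, k i j x := by
  rw [integral_finsetSum]
  · refine Finset.sum_congr rfl fun i _ => ?_
    rw [integral_finsetSum]
    · simp only [integral_const_mul]
    · intro j _
      exact (continuous_const.mul (hk i j)).intervalIntegrable _ _
  · intro i _
    exact (continuous_finsetSum _ fun j _ => continuous_const.mul (hk i j)).intervalIntegrable _ _

/-- The single entry `ε` is the only quantitative content of the cone condition: it bounds `M` below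
pointwise and yields coercivity. -/
lemma posSemidef_quadratic_ge {ι : Type*} [Fintype ι] [DecidableEq ι] {P : Matrix ι ι ℝ} {i : ι}
    {ε : ℝ} (hP : (P - Matrix.single i i ε).PosSemidef) (v : ι → ℝ) :
    ε * v i ^ 2 ≤ v ⬝ᵥ (P *ᵥ v) := by
  have h := hP.dotProduct_mulVec_nonneg v
  rw [Matrix.sub_mulVec, dotProduct_sub, Matrix.single_mulVec_eq] at h
  simp only [star_trivial, dotProduct_smul, dotProduct_single] at h
  simp only [smul_eq_mul] at h
  nlinarith [h]

lemma symm_of_posSemidef_sub_single {ι : Type*} [Fintype ι] [DecidableEq ι] {P : Matrix ι ι ℝ}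
    {i : ι} {ε : ℝ} (hP : (P - Matrix.single i i ε).PosSemidef) (j k : ι) : P j k = P k j := by
  have h := congrFun (congrFun hP.isHermitian j) k
  simp only [Matrix.conjTranspose_apply, Matrix.sub_apply, star_trivial] at h
  have h2 : Matrix.single i i ε k j = Matrix.single i i ε j k := by
    simp only [Matrix.single_apply]
    exact if_congr and_comm rfl rfl
  linarith

lemma MemXi.le_eval {d₁ d₂ : ℕ} {ε : ℝ} {M : Polynomial ℝ} {K₁ K₂ : BiPoly}
    (h : MemXi d₁ d₂ ε M K₁ K₂) (x : ℝ) : ε ≤ M.eval x := by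
  obtain ⟨P, hP, hM, -, -⟩ := h
  have h1 := posSemidef_quadratic_ge hP (Sum.elim (Z₁ d₁ x) 0)
  rw [hM, dotProduct_mulVec_eq_sum]
  rw [dotProduct_mulVec_eq_sum] at h1
  simpa [blk₁, Fintype.sum_sum_type, Z₁] using h1

lemma MemXi.eq_swapVars {d₁ d₂ : ℕ} {ε : ℝ} {M : Polynomial ℝ} {K₁ K₂ : BiPoly}
    (h : MemXi d₁ d₂ ε M K₁ K₂) : K₂ = swapVars K₁ := by
  obtain ⟨P, -, -, -, h⟩ := h
  exact h

/-- The form is a continuous sum of squares, `∫ vᵀ P v`, where the three blocks of `v(η)` are `ηⁱ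
f(η)`, `ηⁱ ∫₀^η ξʲ f` and `ηⁱ ∫_η¹ ξʲ f`. The entry of `v` picked out by `E` is `f` itself. The five
terms of `K₁` are what the blocks of `P` contribute on the triangle `ξ ≤ x`. -/
theorem MemXi.coercive {d₁ d₂ : ℕ} {ε : ℝ} {M : Polynomial ℝ} {K₁ K₂ : BiPoly}
    (h : MemXi d₁ d₂ ε M K₁ K₂) {f : ℝ → ℝ} (hf : Continuous f) :
    ε * ∫ x in (0 : ℝ)..1, f x ^ 2 ≤ ∫ x in (0 : ℝ)..1, f x * op M K₁ f x := by
  obtain ⟨P, hP, hM, hK, -⟩ := h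
  have hsymm := symm_of_posSemidef_sub_single hP
  set g : Mon₂ d₂ → ℝ → ℝ := fun p ξ => ξ ^ (p.1.2 : ℕ) * f ξ with hg
  have hgc : ∀ p, Continuous (g p) := fun p => by simp only [hg]; fun_prop
  set A : Mon₂ d₂ → ℝ → ℝ := fun p η => η ^ (p.1.1 : ℕ) * ∫ ξ in (0 : ℝ)..η, g p ξ with hA
  set B : Mon₂ d₂ → ℝ → ℝ := fun p η => η ^ (p.1.1 : ℕ) * ∫ ξ in η..1, g p ξ with hB
  set Y : Fin (d₁ + 1) → ℝ → ℝ := fun i η => η ^ (i : ℕ) * f η with hY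
  have hAc : ∀ p, Continuous (A p) := fun p => by
    have := continuous_lower (hgc p)
    simp only [hA]; fun_prop
  have hBc : ∀ p, Continuous (B p) := fun p => by
    have := continuous_upper (hgc p)
    simp only [hB]; fun_prop
  have hYc : ∀ i, Continuous (Y i) := fun i => by simp only [hY]; fun_prop
  set v : BlockIdx d₁ d₂ → ℝ → ℝ := Sum.elim Y (Sum.elim A B) with hv
  have hvc : ∀ i, Continuous (v i) := by
    rintro (i | i | i)
    · exact hYc i
    · exact hAc i
    · exact hBc i
  -- integrate the pointwise inequality
  have hpt : ε * ∫ x in (0 : ℝ)..1, f x ^ 2 ≤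
      ∑ i, ∑ j, P i j * ∫ η in (0 : ℝ)..1, v i η * v j η := by
    rw [← integral_sum_sum (fun i j => P i j) (k := fun i j x => v i x * v j x)
      (fun i j => (hvc i).mul (hvc j)), ← integral_const_mul]
    refine integral_mono_on zero_le_one (intervalIntegrable_unit (by fun_prop))
      (intervalIntegrable_unit (continuous_finsetSum _ fun i _ => continuous_finsetSum _
        fun j _ => continuous_const.mul ((hvc i).mul (hvc j)))) fun x _ => ?_
    have := posSemidef_quadratic_ge hP (fun i => v i x)
    rw [dotProduct_mulVec_eq_sum] at this
    simpa [blk₁, hv, hY] using this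
  refine hpt.trans (le_of_eq ?_)
  -- the multiplier part
  have hM' : ∫ x in (0 : ℝ)..1, M.eval x * f x ^ 2 =
      ∑ i, ∑ j, P (blk₁ i) (blk₁ j) * ∫ η in (0 : ℝ)..1, Y i η * Y j η := by
    rw [← integral_sum_sum (fun i j => P (blk₁ i) (blk₁ j)) (k := fun i j x => Y i x * Y j x)
      (fun i j => (hYc i).mul (hYc j))]
    congr 1
    ext x
    rw [hM, dotProduct_mulVec_eq_sum, Finset.sum_mul]
    refine Finset.sum_congr rfl fun i _ => ?_
    rw [Finset.sum_mul]
    refine Finset.sum_congr rfl fun j _ => ?_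
    simp only [Z₁, hY, submatrix_apply]; ring
  -- the elementary kernels
  set k₁₂ : Fin (d₁ + 1) → Mon₂ d₂ → ℝ → ℝ → ℝ :=
    fun i j x ξ => x ^ (i : ℕ) * (x ^ (j.1.1 : ℕ) * ξ ^ (j.1.2 : ℕ)) with hk₁₂
  set k₃₁ : Mon₂ d₂ → Fin (d₁ + 1) → ℝ → ℝ → ℝ :=
    fun i j x ξ => (ξ ^ (i.1.1 : ℕ) * x ^ (i.1.2 : ℕ)) * ξ ^ (j : ℕ) with hk₃₁
  set m : Mon₂ d₂ → Mon₂ d₂ → ℝ → ℝ :=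
    fun i j η => η ^ (i.1.1 : ℕ) * η ^ (j.1.1 : ℕ) with hm
  have hmc : ∀ i j, Continuous (m i j) := fun i j => by simp only [hm]; fun_prop
  set k₃₃ : Mon₂ d₂ → Mon₂ d₂ → ℝ → ℝ → ℝ :=
    fun i j x ξ => x ^ (i.1.2 : ℕ) * ξ ^ (j.1.2 : ℕ) * ∫ η in (0 : ℝ)..ξ, m i j η with hk₃₃
  set k₃₂ : Mon₂ d₂ → Mon₂ d₂ → ℝ → ℝ → ℝ :=
    fun i j x ξ => x ^ (i.1.2 : ℕ) * ξ ^ (j.1.2 : ℕ) * ∫ η in ξ..x, m i j η with hk₃₂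
  set k₂₂ : Mon₂ d₂ → Mon₂ d₂ → ℝ → ℝ → ℝ :=
    fun i j x ξ => x ^ (i.1.2 : ℕ) * ξ ^ (j.1.2 : ℕ) * ∫ η in x..1, m i j η with hk₂₂
  have c₁₂ : ∀ i j, Continuous (Function.uncurry (k₁₂ i j)) := fun i j => by
    simp only [hk₁₂, Function.uncurry_def]; fun_prop
  have c₃₁ : ∀ i j, Continuous (Function.uncurry (k₃₁ i j)) := fun i j => by
    simp only [hk₃₁, Function.uncurry_def]; fun_prop
  have c₃₃ : ∀ i j, Continuous (Function.uncurry (k₃₃ i j)) := fun i j => by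
    have := (continuous_lower (hmc i j)).comp (continuous_snd (X := ℝ))
    simp only [Function.comp_def] at this
    simp only [hk₃₃, Function.uncurry_def]; fun_prop
  have c₂₂ : ∀ i j, Continuous (Function.uncurry (k₂₂ i j)) := fun i j => by
    have := (continuous_upper (hmc i j)).comp (continuous_fst (Y := ℝ))
    simp only [Function.comp_def] at this
    simp only [hk₂₂, Function.uncurry_def]; fun_prop
  have c₃₂ : ∀ i j, Continuous (Function.uncurry (k₃₂ i j)) := fun i j => by
    have h1 := (continuous_lower (hmc i j)).comp (continuous_fst (Y := ℝ))
    have h2 := (continuous_lower (hmc i j)).comp (continuous_snd (X := ℝ))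
    have e : ∀ p : ℝ × ℝ, ∫ η in p.2..p.1, m i j η =
        (∫ η in (0 : ℝ)..p.1, m i j η) - ∫ η in (0 : ℝ)..p.2, m i j η := fun p =>
      (integral_interval_sub_left ((hmc i j).intervalIntegrable _ _)
        ((hmc i j).intervalIntegrable _ _)).symm
    simp only [Function.comp_def] at h1 h2
    simp only [hk₃₂, Function.uncurry_def, e]; fun_prop
  have hZ : ∀ (Q : Matrix (Mon₂ d₂) (Mon₂ d₂) ℝ) (x ξ u w : ℝ),
      (∫ η in u..w, Z₂ d₂ η x ⬝ᵥ (Q *ᵥ Z₂ d₂ η ξ)) =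
        ∑ i, ∑ j, Q i j * (x ^ (i.1.2 : ℕ) * ξ ^ (j.1.2 : ℕ) * ∫ η in u..w, m i j η) := by
    intro Q x ξ u w
    simp only [dotProduct_mulVec_eq_sum]
    rw [integral_sum_sum (fun i j => Q i j) (k := fun i j η => Z₂ d₂ η x i * Z₂ d₂ η ξ j)
      (fun i j => by simp only [Z₂]; fun_prop)]
    refine Finset.sum_congr rfl fun i _ => Finset.sum_congr rfl fun j _ => ?_
    congr 1
    rw [← integral_const_mul]
    congr 1
    ext η
    simp only [Z₂, hm]; ring
  have hval : (fun x ξ => K₁.val x ξ) = fun x ξ =>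
      (∑ i, ∑ j, P (blk₁ i) (blk₂ j) * k₁₂ i j x ξ) + (∑ i, ∑ j, P (blk₃ i) (blk₁ j) * k₃₁ i j x ξ)
      + (∑ i, ∑ j, P (blk₃ i) (blk₃ j) * k₃₃ i j x ξ)
      + (∑ i, ∑ j, P (blk₃ i) (blk₂ j) * k₃₂ i j x ξ)
      + (∑ i, ∑ j, P (blk₂ i) (blk₂ j) * k₂₂ i j x ξ) := by
    ext x ξ
    rw [hK, hZ, hZ, hZ, dotProduct_mulVec_eq_sum, dotProduct_mulVec_eq_sum]
    rfl
  have cs : ∀ {ι κ : Type} [Fintype ι] [Fintype κ] (r : ι → κ → ℝ) (k : ι → κ → ℝ → ℝ → ℝ),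
      (∀ i j, Continuous (Function.uncurry (k i j))) →
      Continuous (Function.uncurry fun x ξ => ∑ i, ∑ j, r i j * k i j x ξ) := by
    intro ι κ _ _ r k hk
    exact continuous_finsetSum _ fun i _ => continuous_finsetSum _
        fun j _ => continuous_const.mul (hk i j)
  have htri : ∫ x in (0 : ℝ)..1, f x * lo K₁ f x =
      (∑ i, ∑ j, P (blk₁ i) (blk₂ j) * tri f (k₁₂ i j))
      + (∑ i, ∑ j, P (blk₃ i) (blk₁ j) * tri f (k₃₁ i j))
      + (∑ i, ∑ j, P (blk₃ i) (blk₃ j) * tri f (k₃₃ i j))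
      + (∑ i, ∑ j, P (blk₃ i) (blk₂ j) * tri f (k₃₂ i j))
      + (∑ i, ∑ j, P (blk₂ i) (blk₂ j) * tri f (k₂₂ i j)) := by
    have : ∫ x in (0 : ℝ)..1, f x * lo K₁ f x = tri f (fun x ξ => K₁.val x ξ) := rfl
    have s₁₂ := cs (fun i j => P (blk₁ i) (blk₂ j)) k₁₂ c₁₂
    have s₃₁ := cs (fun i j => P (blk₃ i) (blk₁ j)) k₃₁ c₃₁
    have s₃₃ := cs (fun i j => P (blk₃ i) (blk₃ j)) k₃₃ c₃₃
    have s₃₂ := cs (fun i j => P (blk₃ i) (blk₂ j)) k₃₂ c₃₂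
    have s₂₂ := cs (fun i j => P (blk₂ i) (blk₂ j)) k₂₂ c₂₂
    rw [this, hval, tri_add hf ?_ s₂₂, tri_add hf ?_ s₃₂, tri_add hf ?_ s₃₃, tri_add hf s₁₂ s₃₁,
      tri_sum_sum (fun i j => P (blk₁ i) (blk₂ j)) hf c₁₂,
      tri_sum_sum (fun i j => P (blk₃ i) (blk₁ j)) hf c₃₁,
      tri_sum_sum (fun i j => P (blk₃ i) (blk₃ j)) hf c₃₃,
      tri_sum_sum (fun i j => P (blk₃ i) (blk₂ j)) hf c₃₂,
      tri_sum_sum (fun i j => P (blk₂ i) (blk₂ j)) hf c₂₂]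
    · exact s₁₂.add s₃₁
    · exact (s₁₂.add s₃₁).add s₃₃
    · exact ((s₁₂.add s₃₁).add s₃₃).add s₃₂
  -- the elementary identities
  have t₁₂ : ∀ i j, ∫ η in (0 : ℝ)..1, Y i η * A j η = tri f (k₁₂ i j) := by
    intro i j
    simp only [tri, hk₁₂, hY, hA, hg, ← integral_const_mul]
    congr 1; ext x; congr 1; ext ξ; ring
  have t₃₁ : ∀ i j, ∫ η in (0 : ℝ)..1, B i η * Y j η = tri f (k₃₁ i j) := by
    intro i j
    have := integral_mul_integral_triangle (f := fun ξ => ξ ^ (i.1.1 : ℕ) * ξ ^ (j : ℕ) * f ξ)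
      (g := g i) (by fun_prop) (hgc i)
    simp only [tri, hk₃₁, hY, hB]
    refine Eq.trans ?_ (this.symm.trans ?_)
    · congr 1; ext x; ring
    · simp only [hg, ← integral_const_mul]
      congr 1; ext x; congr 1; ext ξ; ring
  have t₃₃ : ∀ i j, ∫ η in (0 : ℝ)..1, B i η * B j η = tri f (k₃₃ i j) + tri f (k₃₃ j i) := by
    intro i j
    have := integral_mul_upper_mul_upper (hmc i j) (hgc i) (hgc j)
    refine Eq.trans ?_ (this.trans ?_)
    · congr 1; ext x; simp only [hB, hm]; ring
    · have hmm : m j i = m i j := by ext η; simp only [hm]; ring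
      -- Naming the inner integral keeps the next rewriting from moving factors into it.
      obtain ⟨φ, hφ⟩ : ∃ φ : ℝ → ℝ, ∀ ξ, ∫ η in (0 : ℝ)..ξ, m i j η = φ ξ := ⟨_, fun _ => rfl⟩
      simp only [tri, hk₃₃, hg, hmm, hφ]
      simp only [← integral_const_mul]
      congr 2
      · ext x; congr 1; ext ξ; ring
      · ext x; congr 1; ext ξ; ring
  have t₂₂ : ∀ i j, ∫ η in (0 : ℝ)..1, A i η * A j η = tri f (k₂₂ i j) + tri f (k₂₂ j i) := by
    intro i j
    have := integral_mul_lower_mul_lower (hmc i j) (hgc i) (hgc j)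
    refine Eq.trans ?_ (this.trans ?_)
    · congr 1; ext x; simp only [hA, hm]; ring
    · have hmm : m j i = m i j := by ext η; simp only [hm]; ring
      obtain ⟨φ, hφ⟩ : ∃ φ : ℝ → ℝ, ∀ ξ, ∫ η in ξ..1, m i j η = φ ξ := ⟨_, fun _ => rfl⟩
      simp only [tri, hk₂₂, hg, hmm, hφ]
      simp only [← integral_const_mul]
      congr 2
      · ext x; congr 1; ext ξ; ring
      · ext x; congr 1; ext ξ; ring
  have t₃₂ : ∀ i j, ∫ η in (0 : ℝ)..1, B i η * A j η = tri f (k₃₂ i j) := by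
    intro i j
    have := integral_mul_upper_mul_lower (hmc i j) (hgc i) (hgc j)
    refine Eq.trans ?_ (this.trans ?_)
    · congr 1; ext x; simp only [hA, hB, hm]; ring
    · obtain ⟨φ, hφ⟩ : ∃ φ : ℝ → ℝ → ℝ, ∀ ξ x, ∫ η in ξ..x, m i j η = φ ξ x :=
        ⟨_, fun _ _ => rfl⟩
      simp only [tri, hk₃₂, hg, hφ]
      simp only [← integral_const_mul]
      congr 1; ext x; congr 1; ext ξ; ring
  -- assembling
  have hcomm : ∀ i j, ∫ η in (0 : ℝ)..1, v i η * v j η = ∫ η in (0 : ℝ)..1, v j η * v i η :=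
    fun i j => by congr 1; ext; ring
  have sw : ∀ {ι κ : Type} [Fintype ι] [Fintype κ] (e : ι → BlockIdx d₁ d₂)
      (e' : κ → BlockIdx d₁ d₂),
      ∑ i, ∑ j, P (e i) (e' j) * ∫ η in (0 : ℝ)..1, v (e i) η * v (e' j) η =
      ∑ j, ∑ i, P (e' j) (e i) * ∫ η in (0 : ℝ)..1, v (e' j) η * v (e i) η := by
    intro ι κ _ _ e e'
    rw [Finset.sum_comm]
    refine Finset.sum_congr rfl fun j _ => Finset.sum_congr rfl fun i _ => ?_
    rw [hsymm, hcomm]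
  -- Diagonal blocks produce a kernel and its transpose; by symmetry of `P` both sum to the same
  -- value, matching the factor `2` of `integral_mul_op_self`.
  have dbl : ∀ (e : Mon₂ d₂ → BlockIdx d₁ d₂) (r : Mon₂ d₂ → Mon₂ d₂ → ℝ),
      ∑ i, ∑ j, P (e i) (e j) * (r i j + r j i) = 2 * ∑ i, ∑ j, P (e i) (e j) * r i j := by
    intro e r
    simp only [mul_add, Finset.sum_add_distrib, two_mul]
    congr 1
    rw [Finset.sum_comm]
    refine Finset.sum_congr rfl fun j _ => Finset.sum_congr rfl fun i _ => ?_
    rw [hsymm]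
  have hsplit : ∑ i, ∑ j, P i j * ∫ η in (0 : ℝ)..1, v i η * v j η =
      (∑ i, ∑ j, P (blk₁ i) (blk₁ j) * ∫ η in (0 : ℝ)..1, v (blk₁ i) η * v (blk₁ j) η)
      + (∑ i, ∑ j, P (blk₁ i) (blk₂ j) * ∫ η in (0 : ℝ)..1, v (blk₁ i) η * v (blk₂ j) η)
      + (∑ i, ∑ j, P (blk₁ i) (blk₃ j) * ∫ η in (0 : ℝ)..1, v (blk₁ i) η * v (blk₃ j) η)
      + (∑ i, ∑ j, P (blk₂ i) (blk₁ j) * ∫ η in (0 : ℝ)..1, v (blk₂ i) η * v (blk₁ j) η)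
      + (∑ i, ∑ j, P (blk₂ i) (blk₂ j) * ∫ η in (0 : ℝ)..1, v (blk₂ i) η * v (blk₂ j) η)
      + (∑ i, ∑ j, P (blk₂ i) (blk₃ j) * ∫ η in (0 : ℝ)..1, v (blk₂ i) η * v (blk₃ j) η)
      + (∑ i, ∑ j, P (blk₃ i) (blk₁ j) * ∫ η in (0 : ℝ)..1, v (blk₃ i) η * v (blk₁ j) η)
      + (∑ i, ∑ j, P (blk₃ i) (blk₂ j) * ∫ η in (0 : ℝ)..1, v (blk₃ i) η * v (blk₂ j) η)
      + (∑ i, ∑ j, P (blk₃ i) (blk₃ j) * ∫ η in (0 : ℝ)..1, v (blk₃ i) η * v (blk₃ j) η) := by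
    simp only [Fintype.sum_sum_type, Finset.sum_add_distrib, blk₁, blk₂, blk₃]
    ring
  rw [hsplit, sw blk₁ blk₃, sw blk₂ blk₁, sw blk₂ blk₃, integral_mul_op_self _ _ hf, hM', htri]
  have e₁ : ∀ i : Fin (d₁ + 1), v (blk₁ i) = Y i := fun i => rfl
  have e₂ : ∀ i : Mon₂ d₂, v (blk₂ i) = A i := fun i => rfl
  have e₃ : ∀ i : Mon₂ d₂, v (blk₃ i) = B i := fun i => rfl
  simp only [e₁, e₂, e₃, t₁₂, t₃₁, t₃₃, t₂₂, t₃₂, dbl]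
  ring

end cone

/-! ### Inverting the operator on the space of continuous functions -/

/-- The Banach space of continuous functions on `[0, 1]`. -/
abbrev CI : Type := C(Set.Icc (0 : ℝ) 1, ℝ)

/-- The continuous extension to `ℝ` of a continuous function on `[0, 1]`. -/
def ex (f : CI) : ℝ → ℝ := Set.IccExtend zero_le_one f

@[fun_prop]
lemma continuous_ex (f : CI) : Continuous (ex f) := f.continuous.Icc_extend'

lemma ex_of_mem (f : CI) {x : ℝ} (hx : x ∈ Set.Icc (0 : ℝ) 1) : ex f x = f ⟨x, hx⟩ :=
  Set.IccExtend_of_mem _ _ hx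

@[simp] lemma ex_coe (f : CI) (x : Set.Icc (0 : ℝ) 1) : ex f x = f x := ex_of_mem f x.2

lemma ex_add (f g : CI) (x : ℝ) : ex (f + g) x = ex f x + ex g x := rfl

lemma ex_smul (r : ℝ) (f : CI) (x : ℝ) : ex (r • f) x = r * ex f x := rfl

lemma ex_mul (f g : CI) (x : ℝ) : ex (f * g) x = ex f x * ex g x := rfl

lemma abs_ex_le (f : CI) (x : ℝ) : |ex f x| ≤ ‖f‖ := f.norm_coe_le_norm _

/-- The restriction to `[0, 1]` of a continuous function. -/
def res (f : ℝ → ℝ) (hf : Continuous f) : CI := ⟨fun x => f x, by fun_prop⟩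

lemma ex_res {f : ℝ → ℝ} (hf : Continuous f) {x : ℝ} (hx : x ∈ Set.Icc (0 : ℝ) 1) :
    ex (res f hf) x = f x := by
  rw [ex_of_mem _ hx]; rfl

lemma integral_congr_Icc {f g : ℝ → ℝ} (h : ∀ x ∈ Set.Icc (0 : ℝ) 1, f x = g x) :
    ∫ x in (0 : ℝ)..1, f x = ∫ x in (0 : ℝ)..1, g x :=
  integral_congr fun x hx => h x (by rwa [Set.uIcc_of_le zero_le_one] at hx)

lemma lo_congr (K : BiPoly) {f g : ℝ → ℝ} (h : ∀ x ∈ Set.Icc (0 : ℝ) 1, f x = g x) {x : ℝ}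
    (hx : x ∈ Set.Icc (0 : ℝ) 1) : lo K f x = lo K g x := by
  refine integral_congr fun y hy => ?_
  rw [Set.uIcc_of_le hx.1] at hy
  simp only [h y ⟨hy.1, hy.2.trans hx.2⟩]

lemma up_congr (K : BiPoly) {f g : ℝ → ℝ} (h : ∀ x ∈ Set.Icc (0 : ℝ) 1, f x = g x) {x : ℝ}
    (hx : x ∈ Set.Icc (0 : ℝ) 1) : up K f x = up K g x := by
  refine integral_congr fun y hy => ?_
  rw [Set.uIcc_of_le hx.2] at hy
  simp only [h y ⟨hx.1.trans hy.1, hy.2⟩]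

lemma op_congr (M : Polynomial ℝ) (K : BiPoly) {f g : ℝ → ℝ}
    (h : ∀ x ∈ Set.Icc (0 : ℝ) 1, f x = g x) {x : ℝ}
    (hx : x ∈ Set.Icc (0 : ℝ) 1) : op M K f x = op M K g x := by
  rw [op, op, lo_congr K h hx, up_congr _ h hx, h x hx]

lemma lo_add_fun (K : BiPoly) {f g : ℝ → ℝ} (hf : Continuous f) (hg : Continuous g) (x : ℝ) :
    lo K (fun x => f x + g x) x = lo K f x + lo K g x := by
  simp only [lo, mul_add]
  exact integral_add (by apply Continuous.intervalIntegrable; fun_prop)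
    (by apply Continuous.intervalIntegrable; fun_prop)

lemma up_add_fun (K : BiPoly) {f g : ℝ → ℝ} (hf : Continuous f) (hg : Continuous g) (x : ℝ) :
    up K (fun x => f x + g x) x = up K f x + up K g x := by
  simp only [up, mul_add]
  exact integral_add (by apply Continuous.intervalIntegrable; fun_prop)
    (by apply Continuous.intervalIntegrable; fun_prop)

lemma lo_smul_fun (K : BiPoly) (r : ℝ) (f : ℝ → ℝ) (x : ℝ) :
    lo K (fun x => r * f x) x = r * lo K f x := by
  simp only [lo, mul_left_comm _ r, integral_const_mul]

lemma up_smul_fun (K : BiPoly) (r : ℝ) (f : ℝ → ℝ) (x : ℝ) :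
    up K (fun x => r * f x) x = r * up K f x := by
  simp only [up, mul_left_comm _ r, integral_const_mul]

lemma op_add_fun (M : Polynomial ℝ) (K : BiPoly) {f g : ℝ → ℝ} (hf : Continuous f)
    (hg : Continuous g) (x : ℝ) :
    op M K (fun x => f x + g x) x = op M K f x + op M K g x := by
  simp only [op, lo_add_fun K hf hg, up_add_fun _ hf hg]; ring

lemma op_smul_fun (M : Polynomial ℝ) (K : BiPoly) (r : ℝ) (f : ℝ → ℝ) (x : ℝ) :
    op M K (fun x => r * f x) x = r * op M K f x := by
  simp only [op, lo_smul_fun, up_smul_fun]; ring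

/-- The kernel is bounded on the unit square, so the integral part is controlled in sup norm by the
`L₁` norm. This smoothing lets `L₂` coercivity yield a sup-norm estimate. -/
lemma exists_abs_integral_le (K : BiPoly) : ∃ C, 0 ≤ C ∧ ∀ f : ℝ → ℝ, Continuous f →
    ∀ x ∈ Set.Icc (0 : ℝ) 1, |lo K f x + up (swapVars K) f x| ≤ C * ∫ y in (0 : ℝ)..1, |f y| := by
  obtain ⟨C, hC⟩ := (isCompact_Icc (a := (0 : ℝ)) (b := 1)).prod (isCompact_Icc (a := (0 : ℝ))
    (b := 1)) |>.exists_bound_of_continuousOn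
    (f := fun p : ℝ × ℝ => K.val p.1 p.2) (by fun_prop)
  have hC0 : 0 ≤ C := (norm_nonneg _).trans (hC (0, 0) (by simp))
  refine ⟨C, hC0, fun f hf x hx => ?_⟩
  have h1 : |lo K f x| ≤ C * ∫ y in (0 : ℝ)..x, |f y| := by
    rw [← integral_const_mul, lo, ← Real.norm_eq_abs]
    refine norm_integral_le_of_norm_le hx.1 (Filter.Eventually.of_forall fun y hy => ?_)
      (by apply Continuous.intervalIntegrable; fun_prop)
    rw [norm_mul, Real.norm_eq_abs (f y)]
    exact mul_le_mul_of_nonneg_right (hC (x, y) ⟨hx, hy.1.le, hy.2.trans hx.2⟩) (abs_nonneg _)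
  have h2 : |up (swapVars K) f x| ≤ C * ∫ y in x..1, |f y| := by
    rw [← integral_const_mul, up, ← Real.norm_eq_abs]
    refine norm_integral_le_of_norm_le hx.2 (Filter.Eventually.of_forall fun y hy => ?_)
      (by apply Continuous.intervalIntegrable; fun_prop)
    rw [norm_mul, Real.norm_eq_abs (f y), val_swapVars]
    exact mul_le_mul_of_nonneg_right (hC (y, x) ⟨⟨hx.1.trans hy.1.le, hy.2⟩, hx⟩) (abs_nonneg _)
  have h3 : (∫ y in (0 : ℝ)..x, |f y|) + (∫ y in x..1, |f y|) = ∫ y in (0 : ℝ)..1, |f y| :=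
    integral_add_adjacent_intervals (hf.abs.intervalIntegrable _ _)
      (hf.abs.intervalIntegrable _ _)
  calc _ ≤ |lo K f x| + |up (swapVars K) f x| := abs_add_le _ _
    _ ≤ _ := add_le_add h1 h2
    _ = _ := by rw [← mul_add, h3]

lemma exists_abs_eval_le (M : Polynomial ℝ) :
    ∃ C, 0 ≤ C ∧ ∀ x ∈ Set.Icc (0 : ℝ) 1, |M.eval x| ≤ C := by
  obtain ⟨C, hC⟩ := (isCompact_Icc (a := (0 : ℝ)) (b := 1)).exists_bound_of_continuousOn
    (f := fun x => M.eval x) M.continuous.continuousOn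
  exact ⟨C, (norm_nonneg _).trans (hC 0 (by simp)), hC⟩

/-- The variance of `|f|` on `[0, 1]` is nonnegative. -/
lemma sq_integral_abs_le {f : ℝ → ℝ} (hf : Continuous f) :
    (∫ y in (0 : ℝ)..1, |f y|) ^ 2 ≤ ∫ y in (0 : ℝ)..1, f y ^ 2 := by
  set I := ∫ y in (0 : ℝ)..1, |f y| with hI
  have h : 0 ≤ ∫ y in (0 : ℝ)..1, (f y ^ 2 - (2 * I * |f y| - I ^ 2)) :=
    integral_nonneg zero_le_one fun y _ => by nlinarith [sq_nonneg (|f y| - I), sq_abs (f y)]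
  rw [integral_sub (intervalIntegrable_unit (by fun_prop)) (intervalIntegrable_unit (by fun_prop)),
    integral_sub (intervalIntegrable_unit (by fun_prop)) (intervalIntegrable_unit (by fun_prop)),
    integral_const_mul, ← hI] at h
  simp only [integral_const, sub_zero, one_smul] at h
  nlinarith

/-- `op M K` as a bounded operator on continuous functions. -/
def opCI (M : Polynomial ℝ) (K : BiPoly) : CI →L[ℝ] CI :=
  LinearMap.mkContinuousOfExistsBound
    { toFun := fun f => res (op M K (ex f)) (continuous_op M K (continuous_ex f))
      map_add' := fun f g => by
        ext x
        exact op_add_fun M K (continuous_ex f) (continuous_ex g) x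
      map_smul' := fun r f => by
        ext x
        exact op_smul_fun M K r (ex f) x } (by
    obtain ⟨C₁, h₁, hC₁⟩ := exists_abs_eval_le M
    obtain ⟨C₂, h₂, hC₂⟩ := exists_abs_integral_le K
    refine ⟨C₁ + C₂, fun f => ?_⟩
    refine (ContinuousMap.norm_le _ (by positivity)).2 fun x => ?_
    have e1 : |M.eval (x : ℝ) * ex f x| ≤ C₁ * ‖f‖ := by
      rw [abs_mul]
      exact mul_le_mul (hC₁ x x.2) (abs_ex_le f x) (abs_nonneg _) h₁
    have e2 : ∫ y in (0 : ℝ)..1, |ex f y| ≤ ‖f‖ := by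
      have := integral_mono_on (f := fun y => |ex f y|) (g := fun _ => ‖f‖) zero_le_one
        (intervalIntegrable_unit (by fun_prop)) (intervalIntegrable_unit (by fun_prop))
        fun y _ => abs_ex_le f y
      simpa using this
    have e3 := hC₂ (ex f) (continuous_ex f) x x.2
    have e4 : |op M K (ex f) x| ≤ |M.eval (x : ℝ) * ex f x|
        + |lo K (ex f) x + up (swapVars K) (ex f) x| := by
      rw [op, add_assoc]; exact abs_add_le _ _
    have e5 := mul_le_mul_of_nonneg_left e2 h₂
    calc ‖op M K (ex f) x‖ = |op M K (ex f) x| := rfl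
      _ ≤ (C₁ + C₂) * ‖f‖ := by linarith)

lemma ex_opCI (M : Polynomial ℝ) (K : BiPoly) (f : CI) {x : ℝ} (hx : x ∈ Set.Icc (0 : ℝ) 1) :
    ex (opCI M K f) x = op M K (ex f) x := by
  rw [ex_of_mem _ hx]; rfl

/-- The method of continuity for the segment joining the identity to `T`. -/
lemma isUnit_of_norm_le_segment {E : Type*} [NormedAddCommGroup E] [NormedSpace ℝ E]
    [CompleteSpace E] (T : E →L[ℝ] E) {C : ℝ} (hC : 0 ≤ C)
    (h : ∀ s ∈ Set.Icc (0 : ℝ) 1, ∀ z, ‖z‖ ≤ C * ‖((1 - s) • (1 : E →L[ℝ] E) + s • T) z‖) :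
    IsUnit T := by
  set F : ℝ → E →L[ℝ] E := fun s => (1 - s) • (1 : E →L[ℝ] E) + s • T with hF
  have step : ∀ s ∈ Set.Icc (0 : ℝ) 1, ∀ s', C * (|s' - s| * ‖T - 1‖) < 1 →
      IsUnit (F s) → IsUnit (F s') := by
    rintro s hs s' hlt ⟨u, hu⟩
    have hinv : ‖(↑u⁻¹ : E →L[ℝ] E)‖ ≤ C := by
      refine ContinuousLinearMap.opNorm_le_bound _ hC fun y => ?_
      have h1 := h s hs ((↑u⁻¹ : E →L[ℝ] E) y)
      have h2 : F s ((↑u⁻¹ : E →L[ℝ] E) y) = y := by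
        rw [← hu, ← mul_apply_eq_comp, Units.mul_inv]; rfl
      rwa [show ((1 - s) • (1 : E →L[ℝ] E) + s • T) = F s from rfl, h2] at h1
    -- The a priori estimate bounds the inverse uniformly in `s`, so a Neumann series reaches a
    -- fixed distance along the segment.
    have hfac : F s' = u * (1 - (↑u⁻¹ * ((s - s') • (T - 1)))) := by
      rw [mul_sub, mul_one, ← mul_assoc, Units.mul_inv, one_mul, hu]
      simp only [hF]
      module
    rw [hfac]
    refine u.isUnit.mul (isUnit_one_sub_of_norm_lt_one ?_)
    refine lt_of_le_of_lt ((norm_mul_le _ _).trans ?_) hlt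
    rw [norm_smul, Real.norm_eq_abs, abs_sub_comm s s']
    exact mul_le_mul_of_nonneg_right hinv (by positivity)
  obtain ⟨n, hn⟩ := exists_nat_gt (C * ‖T - 1‖)
  have hn0 : (0 : ℝ) < n := lt_of_le_of_lt (by positivity) hn
  have hk : ∀ k : ℕ, k ≤ n → IsUnit (F (k / n)) := by
    intro k
    induction k with
    | zero => intro _; simp [hF]
    | succ k ih =>
      intro hkn
      have hkn' : (k : ℝ) ≤ n := by exact_mod_cast (Nat.le_of_succ_le hkn)
      refine step (k / n) ⟨by positivity, (div_le_one hn0).2 hkn'⟩ _ ?_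
        (ih (Nat.le_of_succ_le hkn))
      have : ((k + 1 : ℕ) : ℝ) / n - k / n = 1 / n := by push_cast; ring
      rw [this, abs_of_pos (by positivity), mul_left_comm, one_div, inv_mul_lt_iff₀ hn0]
      linarith
  have := hk n le_rfl
  rw [div_self hn0.ne'] at this
  simpa [hF] using this

/-- A coercive operator `op M K` is invertible on continuous functions. -/
theorem isUnit_opCI {M : Polynomial ℝ} {K : BiPoly} {ε : ℝ} (hε : 0 < ε)
    (hM : ∀ x, ε ≤ M.eval x) (hco : ∀ f : ℝ → ℝ, Continuous f →
      ε * ∫ x in (0 : ℝ)..1, f x ^ 2 ≤ ∫ x in (0 : ℝ)..1, f x * op M K f x) :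
    IsUnit (opCI M K) := by
  obtain ⟨C, hC, hCK⟩ := exists_abs_integral_le K
  set m := min 1 ε with hm
  have hm0 : 0 < m := lt_min one_pos hε
  have hm1 : m ≤ 1 := min_le_left _ _
  have hme : m ≤ ε := min_le_right _ _
  refine isUnit_of_norm_le_segment (opCI M K) (C := (1 + C / m) / m) (by positivity) ?_
  intro s hs z
  set y := ((1 - s) • (1 : CI →L[ℝ] CI) + s • opCI M K) z with hy
  have hyx : ∀ x ∈ Set.Icc (0 : ℝ) 1, ex y x = (1 - s) * ex z x + s * op M K (ex z) x :=
    fun x hx => by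
      have : y = (1 - s) • z + s • opCI M K z := rfl
      rw [this, ex_add, ex_smul, ex_smul, ex_opCI M K z hx]
  have hz := continuous_ex z
  have hopz := continuous_op M K hz
  set I := ∫ x in (0 : ℝ)..1, |ex z x| with hI
  have hI0 : 0 ≤ I := integral_nonneg zero_le_one fun _ _ => abs_nonneg _
  -- Testing `y` against `z` gives `m ‖z‖₂² ≤ ‖y‖_∞ ‖z‖₁`, and `‖z‖₁ ≤ ‖z‖₂`. The choice `m = min 1
  -- ε` works along the whole segment.
  have hmI : m * I ≤ ‖y‖ := by
    have h1 : ∫ x in (0 : ℝ)..1, ex z x * ex y x =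
        (1 - s) * (∫ x in (0 : ℝ)..1, ex z x ^ 2)
          + s * ∫ x in (0 : ℝ)..1, ex z x * op M K (ex z) x := by
      rw [← integral_const_mul, ← integral_const_mul, ← integral_add
        (intervalIntegrable_unit (by fun_prop)) (intervalIntegrable_unit (by fun_prop))]
      exact integral_congr_Icc fun x hx => by rw [hyx x hx]; ring
    have h2 : ∫ x in (0 : ℝ)..1, ex z x * ex y x ≤ ‖y‖ * I := by
      rw [hI, ← integral_const_mul]
      refine integral_mono_on zero_le_one (intervalIntegrable_unit (by fun_prop))
        (intervalIntegrable_unit (by fun_prop)) fun x _ => ?_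
      calc ex z x * ex y x ≤ |ex z x * ex y x| := le_abs_self _
        _ = |ex y x| * |ex z x| := by rw [abs_mul, mul_comm]
        _ ≤ _ := mul_le_mul_of_nonneg_right (abs_ex_le y x) (abs_nonneg _)
    have h3 := hco (ex z) hz
    have h4 := sq_integral_abs_le hz
    rw [← hI] at h4
    have h5 : m * I ^ 2 ≤ ‖y‖ * I := by
      have h6 : m ≤ (1 - s) + s * ε := by nlinarith [hs.1, hs.2]
      have h7 : m * I ^ 2 ≤ ((1 - s) + s * ε) * ∫ x in (0 : ℝ)..1, ex z x ^ 2 :=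
        mul_le_mul h6 h4 (sq_nonneg _) (hm0.le.trans h6)
      have h8 := mul_le_mul_of_nonneg_left h3 hs.1
      linarith
    rcases hI0.eq_or_lt with h | h
    · rw [← h, mul_zero]; exact norm_nonneg _
    · refine le_of_mul_le_mul_right ?_ h
      linarith
  refine (ContinuousMap.norm_le _ (by positivity)).2 fun x => ?_
  have hx := hyx x x.2
  have h1 := hCK (ex z) hz x x.2
  rw [← hI] at h1
  have h2 := abs_ex_le y x
  have hMs : m ≤ (1 - s) + s * M.eval (x : ℝ) := by nlinarith [hs.1, hs.2, hM x]
  -- Solving pointwise for `z`: the multiplier is at least `m`, and the integral term is at most `C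
  -- ‖z‖₁ ≤ C ‖y‖ / m`.
  have h3 : ((1 - s) + s * M.eval (x : ℝ)) * ex z x =
      ex y x - s * (lo K (ex z) x + up (swapVars K) (ex z) x) := by
    rw [hx, op]; ring
  have h4 : ((1 - s) + s * M.eval (x : ℝ)) * |ex z x| ≤ ‖y‖ + C * I := by
    calc _ = |((1 - s) + s * M.eval (x : ℝ)) * ex z x| := by
          rw [abs_mul, abs_of_nonneg (hm0.le.trans hMs)]
      _ ≤ |ex y x| + |s * (lo K (ex z) x + up (swapVars K) (ex z) x)| := by
          rw [h3]; exact abs_sub _ _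
      _ ≤ ‖y‖ + C * I := by
          rw [abs_mul, abs_of_nonneg hs.1]
          nlinarith [hs.2, abs_nonneg (lo K (ex z) x + up (swapVars K) (ex z) x)]
  have h5 : m * |ex z x| ≤ ‖y‖ + C * I :=
    (mul_le_mul_of_nonneg_right hMs (abs_nonneg _)).trans h4
  have h6 : I ≤ ‖y‖ / m := by rw [le_div_iff₀ hm0]; linarith
  have h7 : C * I ≤ C * (‖y‖ / m) := mul_le_mul_of_nonneg_left h6 hC
  rw [Real.norm_eq_abs, ← ex_coe, div_mul_eq_mul_div, le_div_iff₀ hm0]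
  calc |ex z x| * m ≤ ‖y‖ + C * (‖y‖ / m) := by linarith
    _ = (1 + C / m) * ‖y‖ := by ring

/-! ### Regularity of preimages -/

lemma contDiff_eval (p : Polynomial ℝ) {n : WithTop ℕ∞} : ContDiff ℝ n fun x => p.eval x := by
  simpa [Polynomial.aeval_def, Polynomial.eval₂_eq_eval_map] using p.contDiff_aeval (𝕜 := ℝ) n

lemma contDiff_val_diag (K : BiPoly) {n : WithTop ℕ∞} : ContDiff ℝ n fun x => K.val x x := by
  have : (fun x => K.val x x) = fun x => (onDiag K).eval x := by ext x; simp
  rw [this]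
  exact contDiff_eval _

/-- The derivative is an operator of the same type, with kernel `D₁ K`, plus a smooth multiple of
`z`; hence the induction runs over all kernels and one order is gained. -/
lemma contDiff_lo (n : ℕ) (K : BiPoly) {z : ℝ → ℝ} (hz : ContDiff ℝ n z) :
    ContDiff ℝ (n + 1 : ℕ) (lo K z) := by
  have hd : ∀ (K : BiPoly), deriv (lo K z) = fun x => lo (D₁ K) z x + K.val x x * z x :=
    fun K => funext fun x => (hasDerivAt_lo K hz.continuous x).deriv
  induction n generalizing K with
  | zero =>
    rw [Nat.cast_add, Nat.cast_one, contDiff_succ_iff_deriv]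
    refine ⟨fun x => (hasDerivAt_lo K hz.continuous x).differentiableAt, by simp, ?_⟩
    rw [hd, Nat.cast_zero, contDiff_zero]
    have := continuous_lo (D₁ K) hz.continuous
    have := hz.continuous
    fun_prop
  | succ n ih =>
    rw [Nat.cast_add, Nat.cast_one, contDiff_succ_iff_deriv]
    refine ⟨fun x => (hasDerivAt_lo K hz.continuous x).differentiableAt, by simp, ?_⟩
    rw [hd]
    exact (ih (D₁ K) (hz.of_le (by exact_mod_cast n.le_succ))).add ((contDiff_val_diag K).mul hz)

lemma contDiff_up (n : ℕ) (K : BiPoly) {z : ℝ → ℝ} (hz : ContDiff ℝ n z) :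
    ContDiff ℝ (n + 1 : ℕ) (up K z) := by
  have hd : ∀ (K : BiPoly), deriv (up K z) = fun x => up (D₁ K) z x - K.val x x * z x :=
    fun K => funext fun x => (hasDerivAt_up K hz.continuous x).deriv
  induction n generalizing K with
  | zero =>
    rw [Nat.cast_add, Nat.cast_one, contDiff_succ_iff_deriv]
    refine ⟨fun x => (hasDerivAt_up K hz.continuous x).differentiableAt, by simp, ?_⟩
    rw [hd, Nat.cast_zero, contDiff_zero]
    have := continuous_up (D₁ K) hz.continuous
    have := hz.continuous
    fun_prop
  | succ n ih =>
    rw [Nat.cast_add, Nat.cast_one, contDiff_succ_iff_deriv]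
    refine ⟨fun x => (hasDerivAt_up K hz.continuous x).differentiableAt, by simp, ?_⟩
    rw [hd]
    exact (ih (D₁ K) (hz.of_le (by exact_mod_cast n.le_succ))).sub ((contDiff_val_diag K).mul hz)

/-- A continuous solution on `[0, 1]` of `op M K z = k` is as smooth as `k`. -/
lemma exists_contDiff_eqOn {M : Polynomial ℝ} {K : BiPoly} (hM : ∀ x, M.eval x ≠ 0)
    {k z : ℝ → ℝ} (hz : Continuous z) (hzk : ∀ x ∈ Set.Icc (0 : ℝ) 1, op M K z x = k x) (n : ℕ)
    (hk : ContDiff ℝ n k) :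
    ∃ y : ℝ → ℝ, ContDiff ℝ n y ∧ ∀ x ∈ Set.Icc (0 : ℝ) 1, y x = z x := by
  induction n with
  | zero => exact ⟨z, by rw [Nat.cast_zero]; exact contDiff_zero.2 hz, fun _ _ => rfl⟩
  | succ n ih =>
    obtain ⟨y, hy, hyz⟩ := ih (hk.of_le (by exact_mod_cast n.le_succ))
    -- Bootstrapping: the equation solved for `z` expresses it through integrals that are one order
    -- smoother.
    refine ⟨fun x => (k x - (lo K y x + up (swapVars K) y x)) / M.eval x,
      (hk.sub ((contDiff_lo n K hy).add (contDiff_up n _ hy))).div (contDiff_eval M) hM,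
      fun x hx => ?_⟩
    rw [div_eq_iff (hM x), ← hzk x hx, lo_congr K hyz hx, up_congr _ hyz hx, op]
    ring

lemma HasC2.contDiff {f f₁ f₂ : ℝ → ℝ} (h : HasC2 f f₁ f₂) : ContDiff ℝ 2 f := by
  have e1 : deriv f = f₁ := funext fun x => (h.deriv₁ x).deriv
  have e2 : deriv f₁ = f₂ := funext fun x => (h.deriv₂ x).deriv
  rw [show (2 : WithTop ℕ∞) = 1 + 1 from rfl, contDiff_succ_iff_deriv]
  refine ⟨fun x => (h.deriv₁ x).differentiableAt, by simp, ?_⟩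
  rw [e1, contDiff_one_iff_deriv, e2]
  exact ⟨fun x => (h.deriv₂ x).differentiableAt, h.cont₂⟩

lemma HasC2.of_contDiff {f : ℝ → ℝ} (h : ContDiff ℝ 2 f) : HasC2 f (deriv f) (deriv (deriv f)) := by
  rw [show (2 : WithTop ℕ∞) = 1 + 1 from rfl, contDiff_succ_iff_deriv] at h
  obtain ⟨h1, -, h2⟩ := h
  rw [contDiff_one_iff_deriv] at h2
  exact ⟨fun x => (h1 x).hasDerivAt, fun x => (h2.1 x).hasDerivAt, h2.2⟩

/-! ### Classical solutions as curves of continuous functions -/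

/-- Integration over `[0, 1]` as a functional on continuous functions. -/
def intCI : CI →L[ℝ] ℝ :=
  LinearMap.mkContinuous
    { toFun := fun f => ∫ x in (0 : ℝ)..1, ex f x
      map_add' := fun f g => by
        simp only [ex_add]
        exact integral_add (intervalIntegrable_unit (continuous_ex f))
          (intervalIntegrable_unit (continuous_ex g))
      map_smul' := fun r f => by
        simp only [ex_smul, integral_const_mul, RingHom.id_apply, smul_eq_mul] } 1 (fun f => by
    have := norm_integral_le_of_norm_le_const (a := (0 : ℝ)) (b := 1) (f := ex f) (C := ‖f‖)
      fun x _ => abs_ex_le f x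
    simpa using this)

lemma intCI_apply (f : CI) : intCI f = ∫ x in (0 : ℝ)..1, ex f x := rfl

/-- Used with `B = S` for the error and with `B = T⁻¹` for the observer state; symmetry merges the
two product-rule terms. -/
lemma hasDerivAt_intCI_mul {W : ℝ → CI} {W' : CI} {t : ℝ} (hW : HasDerivAt W W' t)
    (B : CI →L[ℝ] CI) (hB : ∀ f g : CI, intCI (f * B g) = intCI (g * B f)) :
    HasDerivAt (fun s => intCI (W s * B (W s))) (2 * intCI (W' * B (W t))) t := by
  have h1 : HasDerivAt (fun s => B (W s)) (B W') t := B.hasFDerivAt.comp_hasDerivAt t hW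
  have h2 := intCI.hasFDerivAt.comp_hasDerivAt t (hW.mul h1)
  refine h2.congr_deriv ?_
  rw [map_add, hB (W t) W', two_mul]

/-- The function `g(·, t)` on `[0, 1]` if it is continuous. -/
def slice (g : ℝ → ℝ → ℝ) (t : ℝ) : CI :=
  open Classical in
  if h : ContinuousOn (fun x => g x t) (Set.Icc 0 1) then ⟨fun x => g x t, h.domRestrict⟩ else 0

lemma slice_apply {g : ℝ → ℝ → ℝ} {t : ℝ} (h : ContinuousOn (fun x => g x t) (Set.Icc 0 1))
    (x : Set.Icc (0 : ℝ) 1) : slice g t x = g x t := by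
  rw [slice, dif_pos h]; rfl

lemma ex_slice {g : ℝ → ℝ → ℝ} {t : ℝ} (h : ContinuousOn (fun x => g x t) (Set.Icc 0 1)) {x : ℝ}
    (hx : x ∈ Set.Icc (0 : ℝ) 1) : ex (slice g t) x = g x t := by
  rw [ex_of_mem _ hx, slice_apply h]

lemma continuousOn_slice {g : ℝ → ℝ → ℝ}
    (hg : ContinuousOn (fun p : ℝ × ℝ => g p.1 p.2) (Set.Icc 0 1 ×ˢ Set.Ioi 0)) {t : ℝ}
    (ht : 0 < t) : ContinuousOn (fun x => g x t) (Set.Icc 0 1) :=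
  hg.comp (f := fun x => (x, t)) (by fun_prop) fun _ hx => ⟨hx, ht⟩

/-- The curve `t ↦ g(·, max t τ)`. -/
def clampCurve (g : ℝ → ℝ → ℝ) {τ : ℝ} (hτ : 0 < τ)
    (hg : ContinuousOn (fun p : ℝ × ℝ => g p.1 p.2) (Set.Icc 0 1 ×ˢ Set.Ioi 0)) : C(ℝ, CI) :=
  ContinuousMap.curry ⟨fun p : ℝ × Set.Icc (0 : ℝ) 1 => g p.2 (max p.1 τ),
    hg.comp_continuous (f := fun p : ℝ × Set.Icc (0 : ℝ) 1 => ((p.2 : ℝ), max p.1 τ))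
      (by fun_prop) fun p => ⟨p.2.2, lt_max_of_lt_right hτ⟩⟩

lemma clampCurve_apply (g : ℝ → ℝ → ℝ) {τ : ℝ} (hτ : 0 < τ)
    (hg : ContinuousOn (fun p : ℝ × ℝ => g p.1 p.2) (Set.Icc 0 1 ×ˢ Set.Ioi 0)) {t : ℝ}
    (ht : τ ≤ t) (x : Set.Icc (0 : ℝ) 1) : clampCurve g hτ hg t x = g x t := by
  change g x (max t τ) = g x t
  rw [max_eq_left ht]

/-- Joint continuity of `w_t` makes `w_t(·, t)` a continuous curve in `C[0,1]`. Its Banach-valued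
integral agrees with `w` pointwise, so differentiability holds in sup norm. Clamping time at `t / 2`
stays away from `t = 0`. -/
lemma hasDerivAt_slice {w : ℝ → ℝ → ℝ} (hw : IsC12 w) {t : ℝ} (ht : 0 < t) :
    HasDerivAt (slice w) (slice (dt w) t) t := by
  have hτ : 0 < t / 2 := half_pos ht
  set c := clampCurve w hτ hw.cont with hc
  set c' := clampCurve (dt w) hτ hw.cont_t with hc'
  have hd : HasDerivAt (fun s => c (t / 2) + ∫ r in (t / 2)..s, c' r) (c' t) t :=
    ((c'.continuous.integral_hasStrictDerivAt (t / 2) t).hasDerivAt).const_add _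
  have e1 : c' t = slice (dt w) t := by
    ext x
    rw [slice_apply (continuousOn_slice hw.cont_t ht),
      clampCurve_apply _ hτ _ (half_le_self ht.le)]
  rw [← e1]
  refine hd.congr_of_eventuallyEq ?_
  filter_upwards [lt_mem_nhds (half_lt_self ht)] with s hs
  have hs0 : 0 < s := hτ.trans hs
  ext x
  rw [slice_apply (continuousOn_slice hw.cont hs0)]
  have h1 := ContinuousLinearMap.intervalIntegral_comp_comm (a := t / 2) (b := s)
    (μ := MeasureTheory.volume) (ContinuousMap.evalCLM ℝ x : CI →L[ℝ] ℝ) (f := fun r => c' r)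
    (c'.continuous.intervalIntegrable _ _)
  simp only [ContinuousMap.evalCLM_apply] at h1
  have h2 : ∫ r in (t / 2)..s, c' r x = w x s - w x (t / 2) := by
    refine integral_eq_sub_of_hasDerivAt (f := fun r => w x r) (fun r hr => ?_)
      (Continuous.intervalIntegrable ?_ _ _)
    · rw [Set.uIcc_of_le hs.le] at hr
      rw [clampCurve_apply _ hτ _ hr.1]
      exact (hw.diff_t x x.2 r (hτ.trans_le hr.1)).hasDerivAt
    · exact (continuous_eval_const x).comp c'.continuous
  rw [ContinuousMap.add_apply, ← h1, h2, clampCurve_apply _ hτ _ le_rfl]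
  ring

lemma eq_add_integral_of_diffOn {g g' h : ℝ → ℝ} (hg : DifferentiableOn ℝ g (Set.Icc 0 1))
    (hg' : ∀ x ∈ Set.Icc (0 : ℝ) 1, derivWithin g (Set.Icc 0 1) x = g' x) (hh : Continuous h)
    (hgh : ∀ x ∈ Set.Icc (0 : ℝ) 1, g' x = h x) {x : ℝ} (hx : x ∈ Set.Icc (0 : ℝ) 1) :
    g 0 + ∫ y in (0 : ℝ)..x, h y = g x := by
  have := integral_eq_sub_of_hasDerivAt_of_le (f := g) (f' := h) hx.1
    (hg.continuousOn.mono (Set.Icc_subset_Icc_right hx.2)) (fun y hy => ?_)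
    (hh.intervalIntegrable _ _)
  · linarith
  · have hy' : y ∈ Set.Icc (0 : ℝ) 1 := ⟨hy.1.le, hy.2.le.trans hx.2⟩
    have h1 := (hg y hy').hasDerivWithinAt
    rw [hg' y hy', hgh y hy'] at h1
    exact h1.hasDerivAt (Icc_mem_nhds hy.1 (hy.2.trans_le hx.2))

/-- The state of a classical solution extends to a `C²` function on `ℝ`. -/
lemma exists_hasC2 {w : ℝ → ℝ → ℝ} (hw : IsC12 w) {t : ℝ} (ht : 0 < t) :
    ∃ f f₁ f₂ : ℝ → ℝ, HasC2 f f₁ f₂ ∧ (∀ x ∈ Set.Icc (0 : ℝ) 1, f x = w x t) ∧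
      (∀ x ∈ Set.Icc (0 : ℝ) 1, f₁ x = dx w x t) ∧
      ∀ x ∈ Set.Icc (0 : ℝ) 1, f₂ x = dx (dx w) x t := by
  -- Extend `w_xx` continuously to the line and integrate twice; the two-sided calculus then applies
  -- at the end points.
  set f₂ : ℝ → ℝ := ex (slice (dx (dx w)) t) with hf₂
  have hc₂ : Continuous f₂ := continuous_ex _
  have e₂ : ∀ x ∈ Set.Icc (0 : ℝ) 1, f₂ x = dx (dx w) x t := fun x hx =>
    ex_slice (continuousOn_slice hw.cont_xx ht) hx
  set f₁ : ℝ → ℝ := fun x => dx w 0 t + ∫ y in (0 : ℝ)..x, f₂ y with hf₁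
  have d₁ : ∀ x, HasDerivAt f₁ (f₂ x) x := fun x => (hasDerivAt_lower hc₂ x).const_add _
  have hc₁ : Continuous f₁ := continuous_iff_continuousAt.2 fun x => (d₁ x).continuousAt
  have e₁ : ∀ x ∈ Set.Icc (0 : ℝ) 1, f₁ x = dx w x t := fun x hx =>
    eq_add_integral_of_diffOn (hw.diff_xx t ht) (fun _ _ => rfl) hc₂
      (fun y hy => (e₂ y hy).symm) hx
  refine ⟨fun x => w 0 t + ∫ y in (0 : ℝ)..x, f₁ y, f₁, f₂,
    ⟨fun x => (hasDerivAt_lower hc₁ x).const_add _, d₁, hc₂⟩, fun x hx => ?_, e₁, e₂⟩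
  exact eq_add_integral_of_diffOn (hw.diff_x t ht) (fun _ _ => rfl) hc₁
    (fun y hy => (e₁ y hy).symm) hx

/-! ### Differences of solutions -/

lemma dx_sub {w v : ℝ → ℝ → ℝ} (hw : IsC12 w) (hv : IsC12 v) {x t : ℝ}
    (hx : x ∈ Set.Icc (0 : ℝ) 1) (ht : 0 < t) :
    dx (fun x t => v x t - w x t) x t = dx v x t - dx w x t :=
  derivWithin_fun_sub (hv.diff_x t ht x hx) (hw.diff_x t ht x hx)

lemma dx_dx_sub {w v : ℝ → ℝ → ℝ} (hw : IsC12 w) (hv : IsC12 v) {x t : ℝ}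
    (hx : x ∈ Set.Icc (0 : ℝ) 1) (ht : 0 < t) :
    dx (dx fun x t => v x t - w x t) x t = dx (dx v) x t - dx (dx w) x t := by
  have h1 : dx (dx fun x t => v x t - w x t) x t = dx (fun x t => dx v x t - dx w x t) x t :=
    derivWithin_congr (fun y hy => dx_sub hw hv hy ht) (dx_sub hw hv hx ht)
  rw [h1]
  exact derivWithin_fun_sub (hv.diff_xx t ht x hx) (hw.diff_xx t ht x hx)

lemma dt_sub {w v : ℝ → ℝ → ℝ} (hw : IsC12 w) (hv : IsC12 v) {x t : ℝ}
    (hx : x ∈ Set.Icc (0 : ℝ) 1) (ht : 0 < t) :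
    dt (fun x t => v x t - w x t) x t = dt v x t - dt w x t :=
  deriv_fun_sub (hv.diff_t x hx t ht) (hw.diff_t x hx t ht)

lemma IsC12.sub {w v : ℝ → ℝ → ℝ} (hw : IsC12 w) (hv : IsC12 v) :
    IsC12 fun x t => v x t - w x t where
  diff_t x hx t ht := (hv.diff_t x hx t ht).sub (hw.diff_t x hx t ht)
  diff_x t ht := (hv.diff_x t ht).sub (hw.diff_x t ht)
  diff_xx t ht := ((hv.diff_xx t ht).sub (hw.diff_xx t ht)).congr
    fun _ hy => dx_sub hw hv hy ht
  cont := hv.cont.sub hw.cont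
  cont_t := (hv.cont_t.sub hw.cont_t).congr fun _ hp => dt_sub hw hv hp.1 hp.2
  cont_x := (hv.cont_x.sub hw.cont_x).congr fun _ hp => dx_sub hw hv hp.1 hp.2
  cont_xx := (hv.cont_xx.sub hw.cont_xx).congr fun _ hp => dx_dx_sub hw hv hp.1 hp.2

/-! ### Dissipation inequalities -/

lemma op_neg_sub (M M' : Polynomial ℝ) (K K' : BiPoly) (r s : ℝ) {f : ℝ → ℝ} (hf : Continuous f)
    (x : ℝ) :
    op (-(M' - Polynomial.C r) - Polynomial.C s * M) (-K' - MvPolynomial.C s * K) f x =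
      -op M' K' f x + r * f x - s * op M K f x := by
  have e : -K' - MvPolynomial.C s * K =
      MvPolynomial.C (-1) * K' - MvPolynomial.C s * K := by simp
  have hC : ∀ u : ℝ, swapVars (MvPolynomial.C u) = MvPolynomial.C u := fun u => by simp [swapVars]
  simp only [op, e, swapVars_sub, swapVars_mul, lo_sub _ _ hf, up_sub _ _ hf, hC, lo_C_mul, up_C_mul,
    Polynomial.eval_sub, Polynomial.eval_neg, Polynomial.eval_mul, Polynomial.eval_C]
  ring

/-- The cone with `ε = 0` only asserts a nonnegative form. The term `r` gives back the constant
`π²/2 · αε` subtracted in `Ω`. -/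
lemma integral_mul_op_le {d₁ d₂ : ℕ} {M M' : Polynomial ℝ} {K K' L : BiPoly} {r s : ℝ}
    (h : MemXi d₁ d₂ 0 (-(M' - Polynomial.C r) - Polynomial.C s * M)
      (-K' - MvPolynomial.C s * K) L) {f : ℝ → ℝ} (hf : Continuous f) :
    ∫ x in (0 : ℝ)..1, f x * op M' K' f x ≤
      r * (∫ x in (0 : ℝ)..1, f x ^ 2) - s * ∫ x in (0 : ℝ)..1, f x * op M K f x := by
  have h0 := h.coercive hf
  have c1 := continuous_op M K hf
  have c2 := continuous_op M' K' hf
  have e : ∀ x, f x * op (-(M' - Polynomial.C r) - Polynomial.C s * M)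
      (-K' - MvPolynomial.C s * K) f x =
      r * f x ^ 2 - s * (f x * op M K f x) - f x * op M' K' f x := fun x => by
    rw [op_neg_sub _ _ _ _ _ _ hf]; ring
  simp only [e, zero_mul] at h0
  rw [integral_sub (intervalIntegrable_unit (by fun_prop)) (intervalIntegrable_unit (by fun_prop)),
    integral_sub (intervalIntegrable_unit (by fun_prop)) (intervalIntegrable_unit (by fun_prop)),
    integral_const_mul, integral_const_mul] at h0
  linarith

lemma weighted_wirtinger {a M : Polynomial ℝ} {α ε : ℝ} (hα : 0 < α) (hε : 0 < ε)
    (ha : ∀ x ∈ Set.Icc (0 : ℝ) 1, α ≤ a.eval x) (hM : ∀ x, ε ≤ M.eval x)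
    {f f₁ f₂ : ℝ → ℝ} (h : HasC2 f f₁ f₂) (h0 : f 0 = 0) :
    4 * (α * ε) * ∫ x in (0 : ℝ)..1, f x ^ 2 ≤
      (∫ x in (0 : ℝ)..1, a.eval x * M.eval x * f₁ x ^ 2)
        + 2 * (α * ε) * Real.tan 1 * f 1 ^ 2 := by
  have hf₁ := h.cont₁
  have hac := a.continuous
  have hMc := M.continuous
  have h1 := four_mul_integral_sq_le h.deriv₁ hf₁ h0
  have h2 : α * ε * (∫ x in (0 : ℝ)..1, f₁ x ^ 2) ≤
      ∫ x in (0 : ℝ)..1, a.eval x * M.eval x * f₁ x ^ 2 := by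
    rw [← integral_const_mul]
    refine integral_mono_on zero_le_one (intervalIntegrable_unit (by fun_prop))
      (intervalIntegrable_unit (by fun_prop)) fun x hx => ?_
    exact mul_le_mul_of_nonneg_right
      (mul_le_mul (ha x hx) (hM x) hε.le (hα.le.trans (ha x hx))) (sq_nonneg _)
  have h3 := mul_le_mul_of_nonneg_left h1 (mul_pos hα hε).le
  linarith

/-- Twice the Wirtinger estimate supplies `8αε`, so at least `3αε` remains after paying for the
constant in `Ω`. -/
lemma pi_sq_half_le : Real.pi ^ 2 / 2 ≤ 5 := by
  have h1 := Real.pi_lt_d2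
  have h2 := Real.pi_pos
  nlinarith

/-! ### Smooth preimages and the choice of gains -/

lemma contDiff_val_right (K : BiPoly) (x : ℝ) {n : WithTop ℕ∞} :
    ContDiff ℝ n fun ξ => K.val x ξ := by
  induction K using MvPolynomial.induction_on with
  | C r => simpa using contDiff_const
  | add p q hp hq => simpa using hp.add hq
  | mul_X p i hp =>
    have hi : i = 0 ∨ i = 1 := by fin_cases i <;> simp
    rcases hi with rfl | rfl
    · simpa using hp.mul contDiff_const
    · simpa using hp.mul contDiff_id

/-- Solvability of `op M K z = k` with a smooth solution. -/
lemma exists_smooth_preimage {M : Polynomial ℝ} {K : BiPoly} (hu : IsUnit (opCI M K))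
    (hM : ∀ x, M.eval x ≠ 0) {k : ℝ → ℝ} (hk : ∀ n : ℕ, ContDiff ℝ n k) :
    ∃ z : ℝ → ℝ, Continuous z ∧ ContDiffOn ℝ ∞ z (Set.Icc 0 1) ∧
      ∀ x ∈ Set.Icc (0 : ℝ) 1, op M K z x = k x := by
  obtain ⟨u, hu⟩ := hu
  have hkc : Continuous k := (hk 0).continuous
  set y : CI := (↑u⁻¹ : CI →L[ℝ] CI) (res k hkc) with hy
  have hyk : ∀ x ∈ Set.Icc (0 : ℝ) 1, op M K (ex y) x = k x := fun x hx => by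
    rw [← ex_opCI M K y hx, ← hu, hy, ← mul_apply_eq_comp, Units.mul_inv, one_apply_eq_self,
      ex_res _ hx]
  refine ⟨ex y, continuous_ex y, contDiffOn_infty.2 fun n => ?_, hyk⟩
  obtain ⟨v, hv, hvy⟩ := exists_contDiff_eqOn hM (continuous_ex y) hyk n (hk n)
  exact hv.contDiffOn.congr fun x hx => (hvy x hx).symm

lemma lo_one (K : BiPoly) (f : ℝ → ℝ) : lo K f 1 = ∫ x in (0 : ℝ)..1, K.val 1 x * f x := rfl

/-- The observer gains and the resulting decay of the error Lyapunov function. -/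
theorem exists_observer_gains {a b c : Polynomial ℝ} {α : ℝ} (hα : 0 < α)
    (ha : ∀ x ∈ Set.Icc (0 : ℝ) 1, α ≤ a.eval x) {d₁ d₂ d₁' d₂' : ℕ} {ε δ : ℝ} (hε : 0 < ε)
    {N : Polynomial ℝ} {S₁ S₂ L : BiPoly} (hN : MemXi d₁ d₂ ε N S₁ S₂)
    (hN' : MemXi d₁' d₂' 0
      (-OmegaS.M a b c α ε N S₁ S₂ - Polynomial.C (2 * δ) * N)
      (-OmegaS.K₁ a b c S₁ - MvPolynomial.C (2 * δ) * S₁) L)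
    (hS : ∀ x : ℝ, S₂.val 0 x = 0) :
    ∃ (L₁ : ℝ → ℝ) (L₂ : ℝ), Continuous L₁ ∧ ContDiffOn ℝ ∞ L₁ (Set.Icc 0 1) ∧
      ∀ f f₁ f₂ : ℝ → ℝ, HasC2 f f₁ f₂ → f 0 = 0 → f₁ 1 = L₂ * f 1 →
        2 * ∫ x in (0 : ℝ)..1, (a.eval x * f₂ x + b.eval x * f₁ x + c.eval x * f x + L₁ x * f 1)
          * op N S₁ f x ≤ -(2 * δ) * (∫ x in (0 : ℝ)..1, f x * op N S₁ f x) - f 1 ^ 2 := by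
  have hNx := hN.le_eval
  have hN0 : ∀ x, N.eval x ≠ 0 := fun x => (hε.trans_le (hNx x)).ne'
  have ha1 : 0 < a.eval 1 := hα.trans_le (ha 1 (by simp))
  have hunit := isUnit_opCI hε hNx fun f hf => hN.coercive hf
  have hS₂ := hN.eq_swapVars
  subst hS₂
  set β := (b * N - Polynomial.derivative (a * N)).eval 1 with hβ
  -- The `tan 1` term cancels the boundary cost of Wirtinger, and the `1` leaves `-f(1)²` to pay for
  -- the controller's disturbance.
  set L₂ := -(4 * (α * ε) * Real.tan 1 + 1 + β) / (2 * (a.eval 1 * N.eval 1)) with hL₂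
  have hL₂' : 2 * a.eval 1 * L₂ * N.eval 1 + β = -(4 * (α * ε) * Real.tan 1 + 1) := by
    rw [hL₂]
    have := hN0 1
    field_simp
    ring
  -- The nonlocal boundary term is `2 f(1) ⟨p, f⟩`. Solving `S L₁ = -p` cancels it, since `⟨L₁, S f⟩
  -- = ⟨S L₁, f⟩`.
  set p : ℝ → ℝ := fun x => (a.eval 1 * L₂ + b.eval 1) * S₁.val 1 x
    - (D₁ (inX a * S₁)).val 1 x with hp
  obtain ⟨L₁, hL₁, hL₁s, hL₁p⟩ := exists_smooth_preimage hunit hN0 (k := fun x => -p x) (fun n =>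
    ((contDiff_const.mul (contDiff_val_right _ _)).sub (contDiff_val_right _ _)).neg)
  refine ⟨L₁, L₂, hL₁, hL₁s, fun f f₁ f₂ h h0 h1 => ?_⟩
  have hf := h.cont
  have hf₁ := h.cont₁
  have hf₂ := h.cont₂
  have hac := a.continuous
  have hbc := b.continuous
  have hcc := c.continuous
  have hop := continuous_op N S₁ hf
  have key := two_mul_integral_generator_mul_op a b c N S₁ h h0 hS
  have hform := integral_mul_op_le (r := Real.pi ^ 2 / 2 * α * ε) hN' hf
  have hw := weighted_wirtinger hα hε ha hNx h h0
  have hcross : ∫ x in (0 : ℝ)..1, L₁ x * op N S₁ f x =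
      -((a.eval 1 * L₂ + b.eval 1) * lo S₁ f 1 - lo (D₁ (inX a * S₁)) f 1) := by
    rw [integral_mul_op_comm N S₁ hf hL₁, lo_one, lo_one, ← integral_const_mul, ← integral_sub
      (intervalIntegrable_unit (by fun_prop)) (intervalIntegrable_unit (by fun_prop)),
      ← integral_neg]
    exact integral_congr_Icc fun x hx => by rw [hL₁p x hx]; simp only [hp]; ring
  have hsplit : ∫ x in (0 : ℝ)..1, (a.eval x * f₂ x + b.eval x * f₁ x + c.eval x * f x
      + L₁ x * f 1) * op N S₁ f x =
      (∫ x in (0 : ℝ)..1, (a.eval x * f₂ x + b.eval x * f₁ x + c.eval x * f x) * op N S₁ f x)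
        + f 1 * ∫ x in (0 : ℝ)..1, L₁ x * op N S₁ f x := by
    rw [← integral_const_mul, ← integral_add
      (intervalIntegrable_unit (by fun_prop)) (intervalIntegrable_unit (by fun_prop))]
    congr 1; ext x; ring
  have hop1 : op N S₁ f 1 = N.eval 1 * f 1 + lo S₁ f 1 := by rw [op, up_at_one, add_zero]
  have hI : 0 ≤ ∫ x in (0 : ℝ)..1, f x ^ 2 := integral_nonneg zero_le_one fun _ _ => sq_nonneg _
  have hpi : Real.pi ^ 2 / 2 * α * ε * (∫ x in (0 : ℝ)..1, f x ^ 2) ≤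
      8 * (α * ε) * ∫ x in (0 : ℝ)..1, f x ^ 2 := by
    rw [mul_assoc _ α ε]
    exact mul_le_mul_of_nonneg_right (mul_le_mul_of_nonneg_right
      (by linarith [pi_sq_half_le]) (mul_pos hα hε).le) hI
  rw [hsplit, hcross]
  rw [hop1, h1, ← hβ] at key
  have hb : 2 * a.eval 1 * (L₂ * f 1) * (N.eval 1 * f 1 + lo S₁ f 1) + β * f 1 ^ 2
      + 2 * f 1 * (b.eval 1 * lo S₁ f 1 - lo (D₁ (inX a * S₁)) f 1) =
      -(4 * (α * ε) * Real.tan 1 + 1) * f 1 ^ 2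
      + 2 * f 1 * ((a.eval 1 * L₂ + b.eval 1) * lo S₁ f 1 - lo (D₁ (inX a * S₁)) f 1) := by
    rw [← hL₂']; ring
  rw [hb] at key
  linarith

/-- The controller gains and the resulting decay of the state Lyapunov function, up to a
disturbance. -/
theorem exists_controller_gains {a b c : Polynomial ℝ} {α : ℝ} (hα : 0 < α)
    (ha : ∀ x ∈ Set.Icc (0 : ℝ) 1, α ≤ a.eval x) {d₁ d₂ d₁' d₂' : ℕ} {ε μ : ℝ} (hε : 0 < ε)
    {M : Polynomial ℝ} {K₁ K₂ L : BiPoly} (hM : MemXi d₁ d₂ ε M K₁ K₂)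
    (hM' : MemXi d₁' d₂' 0
      (-OmegaC.M a b c α ε M K₁ K₂ - Polynomial.C (2 * μ) * M)
      (-OmegaC.K₁ a b c K₁ - MvPolynomial.C (2 * μ) * K₁) L)
    (hK : ∀ x : ℝ, K₂.val 0 x = 0) :
    ∃ (R₁ : ℝ) (R₂ : ℝ → ℝ), ContDiffOn ℝ ∞ R₂ (Set.Icc 0 1) ∧
      ∀ (L₁ : ℝ → ℝ) (L₂ : ℝ), Continuous L₁ → ∃ C, 0 ≤ C ∧
      ∀ (f f₁ f₂ z : ℝ → ℝ) (e : ℝ), HasC2 f f₁ f₂ → Continuous z →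
        (∀ x ∈ Set.Icc (0 : ℝ) 1, op M K₁ z x = f x) → f 0 = 0 →
        f₁ 1 = R₁ * f 1 + (∫ x in (0 : ℝ)..1, R₂ x * f x) + L₂ * e →
        2 * ∫ x in (0 : ℝ)..1, (a.eval x * f₂ x + b.eval x * f₁ x + c.eval x * f x + L₁ x * e)
          * z x ≤ -(2 * μ) * (∫ x in (0 : ℝ)..1, f x * z x) + C * e ^ 2 := by
  have hMx := hM.le_eval
  have hM0 : ∀ x, M.eval x ≠ 0 := fun x => (hε.trans_le (hMx x)).ne'
  have ha1 : 0 < a.eval 1 := hα.trans_le (ha 1 (by simp))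
  have hunit := isUnit_opCI hε hMx fun f hf => hM.coercive hf
  have hK₂ := hM.eq_swapVars
  subst hK₂
  set β := (b * M - Polynomial.derivative (a * M)).eval 1 with hβ
  -- The gains are to enforce `f₁(1) - lo (D₁ K₁) z 1 = ρ z(1) + L₂ e`. Here `ρ` pays for Wirtinger
  -- and leaves `-z(1)²`; `R₁` produces `ρ z(1)`, and `R₂` supplies the integral terms.
  set ρ := -(4 * (α * ε) * Real.tan 1 + 1 + β) / (2 * a.eval 1) with hρ
  have hρ' : 2 * a.eval 1 * ρ + β = -(4 * (α * ε) * Real.tan 1 + 1) := by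
    rw [hρ]
    field_simp
    ring
  set R₁ := ρ / M.eval 1 with hR₁
  have hR₁' : R₁ * M.eval 1 = ρ := div_mul_cancel₀ _ (hM0 1)
  obtain ⟨R₂, hR₂, hR₂s, hR₂k⟩ := exists_smooth_preimage hunit hM0
    (k := fun x => (D₁ K₁).val 1 x - R₁ * K₁.val 1 x) (fun n =>
    (contDiff_val_right _ _).sub (contDiff_const.mul (contDiff_val_right _ _)))
  refine ⟨R₁, R₂, hR₂s, fun L₁ L₂ hL₁ => ?_⟩
  have hσ : 0 < 3 * (α * ε) := by positivity
  set Λ := ∫ x in (0 : ℝ)..1, L₁ x ^ 2 with hΛ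
  have hΛ0 : 0 ≤ Λ := integral_nonneg zero_le_one fun _ _ => sq_nonneg _
  -- The two summands come from absorbing `L₂ e` into `-z(1)²` and `L₁ e` into the spare `3αε ∫ z²`.
  refine ⟨(a.eval 1 * L₂) ^ 2 + Λ / (3 * (α * ε)), by positivity, ?_⟩
  intro f f₁ f₂ z₀ e h hz₀ hz₀f h0 hbc
  obtain ⟨z, hzs, hzz⟩ := exists_contDiff_eqOn hM0 hz₀ hz₀f 2 (by exact_mod_cast h.contDiff)
  have hz := HasC2.of_contDiff (by exact_mod_cast hzs)
  have hzf : ∀ x ∈ Set.Icc (0 : ℝ) 1, op M K₁ z x = f x := fun x hx => by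
    rw [op_congr M K₁ hzz hx, hz₀f x hx]
  have e1 : ∫ x in (0 : ℝ)..1, (a.eval x * f₂ x + b.eval x * f₁ x + c.eval x * f x + L₁ x * e)
      * z₀ x = ∫ x in (0 : ℝ)..1, (a.eval x * f₂ x + b.eval x * f₁ x + c.eval x * f x + L₁ x * e)
      * z x := integral_congr_Icc fun x hx => by rw [hzz x hx]
  have e2 : ∫ x in (0 : ℝ)..1, f x * z₀ x = ∫ x in (0 : ℝ)..1, z x * op M K₁ z x :=
    integral_congr_Icc fun x hx => by rw [hzf x hx, hzz x hx, mul_comm]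
  rw [e1, e2]
  have hzc := hz.cont
  have hf := h.cont
  have hf₁ := h.cont₁
  have hf₂ := h.cont₂
  have hac := a.continuous
  have hbc' := b.continuous
  have hcc := c.continuous
  -- At `x = 0` the integral part of `op M K₁ z` vanishes with `K₂(0, ·)`, so `f(0) = M(0) z(0)`.
  have hz0 : z 0 = 0 := by
    have := hzf 0 (by simp)
    rw [op, lo_at_zero, h0] at this
    have h2 : up (swapVars K₁) z 0 = 0 := by simp only [up, hK]; simp
    rw [h2, add_zero, add_zero] at this
    exact (mul_eq_zero.1 this).resolve_left (hM0 0)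
  have key := two_mul_integral_generator_op_mul a b c M K₁ h hz hzf hz0
  have hform : ∫ x in (0 : ℝ)..1, z x * op ((a.derivative.derivative - b.derivative) * M
        + b * M.derivative + a * M.derivative.derivative + 2 * c * M
        + a * (2 * onDiag (D₁ (K₁ - swapVars K₁)))) (OmegaC.K₁ a b c K₁) z x ≤
      Real.pi ^ 2 / 2 * α * ε * (∫ x in (0 : ℝ)..1, z x ^ 2)
        - 2 * μ * ∫ x in (0 : ℝ)..1, z x * op M K₁ z x := by
    have hpoly : OmegaC.M a b c α ε M K₁ (swapVars K₁) =
        ((a.derivative.derivative - b.derivative) * M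
        + b * M.derivative + a * M.derivative.derivative + 2 * c * M
        + a * (2 * onDiag (D₁ (K₁ - swapVars K₁)))) - Polynomial.C (Real.pi ^ 2 / 2 * α * ε) := by
      rw [OmegaC.M]; ring
    rw [hpoly] at hM'
    exact integral_mul_op_le hM' hzc
  have hw := weighted_wirtinger hα hε ha hMx hz hz0
  have hfeed : f₁ 1 - lo (D₁ K₁) z 1 = ρ * z 1 + L₂ * e := by
    have i1 : ∫ x in (0 : ℝ)..1, R₂ x * f x = lo (D₁ K₁) z 1 - R₁ * lo K₁ z 1 := by
      rw [integral_congr_Icc (g := fun x => R₂ x * op M K₁ z x)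
        (fun x hx => by rw [hzf x hx]), integral_mul_op_comm M K₁ hzc hR₂, lo_one, lo_one,
        ← integral_const_mul, ← integral_sub (intervalIntegrable_unit (by fun_prop))
        (intervalIntegrable_unit (by fun_prop))]
      exact integral_congr_Icc fun x hx => by rw [hR₂k x hx]; ring
    have i2 : f 1 = M.eval 1 * z 1 + lo K₁ z 1 := by
      rw [← hzf 1 (by simp), op, up_at_one, add_zero]
    rw [hbc, i1, i2, ← hR₁']; ring
  rw [hfeed, ← hβ] at key
  have hb : 2 * a.eval 1 * z 1 * (ρ * z 1 + L₂ * e) + β * z 1 ^ 2 =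
      -(4 * (α * ε) * Real.tan 1 + 1) * z 1 ^ 2 + 2 * (a.eval 1 * L₂ * e) * z 1 := by
    rw [← hρ']; ring
  rw [hb] at key
  have hsplit : ∫ x in (0 : ℝ)..1, (a.eval x * f₂ x + b.eval x * f₁ x + c.eval x * f x
      + L₁ x * e) * z x =
      (∫ x in (0 : ℝ)..1, (a.eval x * f₂ x + b.eval x * f₁ x + c.eval x * f x) * z x)
        + ∫ x in (0 : ℝ)..1, e * L₁ x * z x := by
    rw [← integral_add
      (intervalIntegrable_unit (by fun_prop)) (intervalIntegrable_unit (by fun_prop))]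
    congr 1; ext x; ring
  have hI : 0 ≤ ∫ x in (0 : ℝ)..1, z x ^ 2 := integral_nonneg zero_le_one fun _ _ => sq_nonneg _
  have hpi : Real.pi ^ 2 / 2 * α * ε * (∫ x in (0 : ℝ)..1, z x ^ 2) ≤
      5 * (α * ε) * ∫ x in (0 : ℝ)..1, z x ^ 2 := by
    rw [mul_assoc _ α ε]
    exact mul_le_mul_of_nonneg_right (mul_le_mul_of_nonneg_right
      pi_sq_half_le (mul_pos hα hε).le) hI
  have hyoung : 2 * (∫ x in (0 : ℝ)..1, e * L₁ x * z x) ≤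
      3 * (α * ε) * (∫ x in (0 : ℝ)..1, z x ^ 2) + e ^ 2 / (3 * (α * ε)) * Λ := by
    rw [hΛ, ← integral_const_mul, ← integral_const_mul, ← integral_const_mul, ← integral_add
      (intervalIntegrable_unit (by fun_prop)) (intervalIntegrable_unit (by fun_prop))]
    refine integral_mono_on zero_le_one (intervalIntegrable_unit (by fun_prop))
      (intervalIntegrable_unit (by fun_prop)) fun x _ => ?_
    have hsq := div_nonneg (sq_nonneg (3 * (α * ε) * z x - e * L₁ x)) hσ.le
    have : 3 * (α * ε) * z x ^ 2 + e ^ 2 / (3 * (α * ε)) * L₁ x ^ 2 - 2 * (e * L₁ x * z x) =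
        (3 * (α * ε) * z x - e * L₁ x) ^ 2 / (3 * (α * ε)) := by
      field_simp; ring
    linarith
  have hC : ((a.eval 1 * L₂) ^ 2 + Λ / (3 * (α * ε))) * e ^ 2 =
      (a.eval 1 * L₂ * e) ^ 2 + e ^ 2 / (3 * (α * ε)) * Λ := by ring
  have hsq2 := sq_nonneg (z 1 - a.eval 1 * L₂ * e)
  rw [hsplit, hC]
  linarith

/-! ### The Lyapunov functionals -/

lemma intCI_mul_opCI (M : Polynomial ℝ) (K : BiPoly) (f g : CI) :
    intCI (f * opCI M K g) = ∫ x in (0 : ℝ)..1, ex f x * op M K (ex g) x := by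
  rw [intCI_apply]
  exact integral_congr_Icc fun x hx => by rw [ex_mul, ex_opCI M K g hx]

lemma intCI_mul_opCI_comm (M : Polynomial ℝ) (K : BiPoly) (f g : CI) :
    intCI (f * opCI M K g) = intCI (g * opCI M K f) := by
  rw [intCI_mul_opCI, intCI_mul_opCI,
    integral_mul_op_comm M K (continuous_ex g) (continuous_ex f)]

/-- An inverse of a symmetric operator is symmetric; evaluate the symmetry at `B g` and `B f`. -/
lemma intCI_mul_inv_comm {M : Polynomial ℝ} {K : BiPoly} {B : CI →L[ℝ] CI}
    (hB : ∀ f, opCI M K (B f) = f) (f g : CI) : intCI (f * B g) = intCI (g * B f) := by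
  have h := intCI_mul_opCI_comm M K (B g) (B f)
  rw [hB, hB] at h
  rw [mul_comm f, mul_comm g, h]

lemma exists_integral_op_sq_le (M : Polynomial ℝ) (K : BiPoly) :
    ∃ C, 0 ≤ C ∧ ∀ f : ℝ → ℝ, Continuous f →
      ∫ x in (0 : ℝ)..1, op M K f x ^ 2 ≤ C * ∫ x in (0 : ℝ)..1, f x ^ 2 := by
  obtain ⟨C₁, h₁, hC₁⟩ := exists_abs_eval_le M
  obtain ⟨C₂, h₂, hC₂⟩ := exists_abs_integral_le K
  refine ⟨2 * C₁ ^ 2 + 2 * C₂ ^ 2, by positivity, fun f hf => ?_⟩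
  set I := ∫ x in (0 : ℝ)..1, |f x| with hI
  have hop := continuous_op M K hf
  have h1 : ∫ x in (0 : ℝ)..1, op M K f x ^ 2 ≤
      ∫ x in (0 : ℝ)..1, (2 * C₁ ^ 2 * f x ^ 2 + 2 * C₂ ^ 2 * I ^ 2) := by
    refine integral_mono_on zero_le_one (intervalIntegrable_unit (by fun_prop))
      (intervalIntegrable_unit (by fun_prop)) fun x hx => ?_
    have e1 : (M.eval x * f x) ^ 2 ≤ C₁ ^ 2 * f x ^ 2 := by
      rw [mul_pow]
      exact mul_le_mul_of_nonneg_right (sq_le_sq' (abs_le.1 (hC₁ x hx)).1 (abs_le.1 (hC₁ x hx)).2)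
        (sq_nonneg _)
    have e2 := abs_le.1 (hC₂ f hf x hx)
    have e3 : (lo K f x + up (swapVars K) f x) ^ 2 ≤ C₂ ^ 2 * I ^ 2 := by
      rw [← mul_pow]; exact sq_le_sq' e2.1 e2.2
    have e4 : op M K f x = M.eval x * f x + (lo K f x + up (swapVars K) f x) := by rw [op]; ring
    rw [e4]
    nlinarith [sq_nonneg (M.eval x * f x - (lo K f x + up (swapVars K) f x))]
  rw [integral_add (intervalIntegrable_unit (by fun_prop)) (intervalIntegrable_unit (by fun_prop)),
    integral_const_mul] at h1
  simp only [integral_const, sub_zero, one_smul] at h1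
  have h2 := sq_integral_abs_le hf
  rw [← hI] at h2
  nlinarith [mul_le_mul_of_nonneg_left h2 (by positivity : 0 ≤ 2 * C₂ ^ 2)]

lemma two_mul_integral_mul_le {f g : ℝ → ℝ} (hf : Continuous f) (hg : Continuous g) {r : ℝ}
    (hr : 0 < r) :
    2 * ∫ x in (0 : ℝ)..1, f x * g x ≤
      r * (∫ x in (0 : ℝ)..1, f x ^ 2) + r⁻¹ * ∫ x in (0 : ℝ)..1, g x ^ 2 := by
  rw [← integral_const_mul, ← integral_const_mul, ← integral_const_mul, ← integral_add
    (intervalIntegrable_unit (by fun_prop)) (intervalIntegrable_unit (by fun_prop))]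
  refine integral_mono_on zero_le_one (intervalIntegrable_unit (by fun_prop))
    (intervalIntegrable_unit (by fun_prop)) fun x _ => ?_
  have h := mul_nonneg (inv_nonneg.2 hr.le) (sq_nonneg (r * f x - g x))
  have e : r⁻¹ * (r * f x - g x) ^ 2 = r * f x ^ 2 + r⁻¹ * g x ^ 2 - 2 * (f x * g x) := by
    field_simp; ring
  linarith

/-- The function `V(y) exp(r y)` is nonincreasing. The start must be positive, as nothing is assumed
at time `0`. -/
lemma exp_decay_of_hasDerivAt_le {V V' : ℝ → ℝ} {r : ℝ} (h : ∀ t > 0, HasDerivAt V (V' t) t)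
    (hle : ∀ t > 0, V' t ≤ -r * V t) {s t : ℝ} (hs : 0 < s) (hst : s ≤ t) :
    V t ≤ V s * Real.exp (-r * (t - s)) := by
  have hd : ∀ y > 0, HasDerivAt (fun y => V y * Real.exp (r * y))
      (V' y * Real.exp (r * y) + V y * (Real.exp (r * y) * (r * 1))) y := fun y hy =>
    (h y hy).mul (((hasDerivAt_id y).const_mul r).exp)
  have hanti : AntitoneOn (fun y => V y * Real.exp (r * y)) (Set.Ici s) := by
    refine antitoneOn_of_deriv_nonpos (convex_Ici s)
      (fun y hy => (hd y (hs.trans_le hy)).continuousAt.continuousWithinAt)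
      (fun y hy => (hd y (hs.trans_le (interior_subset hy))).differentiableAt.differentiableWithinAt)
      fun y hy => ?_
    have hy0 : 0 < y := hs.trans_le (interior_subset hy)
    rw [(hd y hy0).deriv]
    have := mul_le_mul_of_nonneg_right (hle y hy0) (Real.exp_pos (r * y)).le
    linarith
  have h1 : V t * Real.exp (r * t) ≤ V s * Real.exp (r * s) := hanti Set.self_mem_Ici hst hst
  have e1 : Real.exp (-r * (t - s)) = Real.exp (r * s) * (Real.exp (r * t))⁻¹ := by
    rw [← Real.exp_neg, ← Real.exp_add]; ring_nf
  rw [e1, ← mul_assoc, ← div_eq_mul_inv, le_div_iff₀ (Real.exp_pos _)]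
  exact h1

/-! ### Initial states -/

lemma integral_sq_nonneg (f : ℝ → ℝ) : 0 ≤ ∫ x in (0 : ℝ)..1, f x ^ 2 :=
  integral_nonneg zero_le_one fun _ _ => sq_nonneg _

lemma l2norm_sq (f : ℝ → ℝ) : l2norm f ^ 2 = ∫ x in (0 : ℝ)..1, f x ^ 2 :=
  Real.sq_sqrt (integral_sq_nonneg f)

lemma intervalIntegrable_sq_of_memLp {f : ℝ → ℝ}
    (hf : MemLp f 2 (volume.restrict (Set.Icc (0 : ℝ) 1))) :
    IntervalIntegrable (fun x => f x ^ 2) volume 0 1 :=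
  (intervalIntegrable_iff_integrableOn_Icc_of_le zero_le_one).2 hf.integrable_sq

lemma memLp_ex (f : CI) : MemLp (ex f) 2 (volume.restrict (Set.Icc (0 : ℝ) 1)) :=
  MemLp.of_bound (continuous_ex f).aestronglyMeasurable ‖f‖
    (Filter.Eventually.of_forall fun x => abs_ex_le f x)

lemma integral_sq_le_initial {w : ℝ → ℝ → ℝ} (hw : IsC12 w) (h0 : AttainsInitial w) {s : ℝ}
    (hs : 0 < s) :
    ∫ x in (0 : ℝ)..1, w x s ^ 2 ≤
      2 * l2norm (fun x => w x s - w x 0) ^ 2 + 2 * ∫ x in (0 : ℝ)..1, w x 0 ^ 2 := by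
  have hex : ∀ x ∈ Set.Icc (0 : ℝ) 1, ex (slice w s) x = w x s := fun x hx =>
    ex_slice (continuousOn_slice hw.cont hs) hx
  rw [l2norm_sq, integral_congr_Icc (f := fun x => w x s ^ 2) (g := fun x => ex (slice w s) x ^ 2)
    (fun x hx => by rw [hex x hx]),
    integral_congr_Icc (f := fun x => (w x s - w x 0) ^ 2)
    (g := fun x => (ex (slice w s) x - w x 0) ^ 2) (fun x hx => by rw [hex x hx])]
  have i1 := intervalIntegrable_sq_of_memLp ((memLp_ex (slice w s)).sub h0.memLp)
  have i2 := intervalIntegrable_sq_of_memLp h0.memLp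
  simp only [Pi.sub_apply] at i1
  rw [← integral_const_mul, ← integral_const_mul, ← integral_add (i1.const_mul 2) (i2.const_mul 2)]
  refine integral_mono_on zero_le_one (intervalIntegrable_unit (by fun_prop))
    ((i1.const_mul 2).add (i2.const_mul 2)) fun x _ => ?_
  nlinarith [sq_nonneg (ex (slice w s) x - w x 0 - w x 0)]

end ParabolicSOS

end

/-! ### The closed loop: composite Lyapunov function and passage to the initial time -/

open ParabolicSOS in
theorem theorem6
    (a b c : Polynomial ℝ) (α : ℝ) (hα : 0 < α) (ha : ∀ x ∈ Set.Icc (0 : ℝ) 1, α ≤ a.eval x)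
    (d₁ d₂ d₁' d₂' : ℕ) (ε δ μ : ℝ) (hε : 0 < ε) (hδ : 0 < δ) (hμ : 0 < μ)
    (M N : Polynomial ℝ) (K₁ K₂ S₁ S₂ : BiPoly)
    (hM : MemXi d₁ d₂ ε M K₁ K₂)
    (hM' : MemXi d₁' d₂' 0
      (-OmegaC.M a b c α ε M K₁ K₂ - Polynomial.C (2 * μ) * M)
      (-OmegaC.K₁ a b c K₁ - MvPolynomial.C (2 * μ) * K₁)
      (-OmegaC.K₂ a b c K₁ - MvPolynomial.C (2 * μ) * K₂))
    (hK : ∀ x : ℝ, K₂.val 0 x = 0)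
    (hN : MemXi d₁ d₂ ε N S₁ S₂)
    (hN' : MemXi d₁' d₂' 0
      (-OmegaS.M a b c α ε N S₁ S₂ - Polynomial.C (2 * δ) * N)
      (-OmegaS.K₁ a b c S₁ - MvPolynomial.C (2 * δ) * S₁)
      (-OmegaS.K₂ a b c S₁ - MvPolynomial.C (2 * δ) * S₂))
    (hS : ∀ x : ℝ, S₂.val 0 x = 0) :
    ∃ (R₁ : ℝ) (R₂ : ℝ → ℝ) (L₁ : ℝ → ℝ) (L₂ : ℝ),
      ContDiffOn ℝ ∞ R₂ (Set.Icc 0 1) ∧ ContDiffOn ℝ ∞ L₁ (Set.Icc 0 1) ∧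
      ∃ γ : ℝ, 0 < γ ∧ ∀ κ : ℝ, 0 < κ → κ < min μ δ →
        ∀ w w' : ℝ → ℝ → ℝ,
          IsPlantSolution a b c (feedback R₁ R₂ w') w →
          IsObserverSolution a b c L₁ L₂ (feedback R₁ R₂ w') (fun t => w 1 t) w' →
          (∀ x ∈ Set.Icc (0 : ℝ) 1, w' x 0 = 0) →
          ∀ t : ℝ, 0 ≤ t →
            l2norm (fun x => w x t) ≤ γ * l2norm (fun x => w x 0) * Real.exp (-κ * t) := by
  obtain ⟨L₁, L₂, hL₁, hL₁s, hobs⟩ := exists_observer_gains hα ha hε hN hN' hS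
  obtain ⟨R₁, R₂, hR₂s, hctr⟩ := exists_controller_gains hα ha hε hM hM' hK
  obtain ⟨C, hC, hctr⟩ := hctr L₁ L₂ hL₁
  obtain ⟨CM, hCM, hopM⟩ := exists_integral_op_sq_le M K₁
  obtain ⟨CN, hCN, hopN⟩ := exists_integral_op_sq_le N S₁
  obtain ⟨u, hu⟩ := isUnit_opCI hε hM.le_eval fun f hf => hM.coercive hf
  set B : CI →L[ℝ] CI := (↑u⁻¹ : CI →L[ℝ] CI) with hBdef
  have hB : ∀ f, opCI M K₁ (B f) = f := fun f => by
    rw [← hu, hBdef, ← mul_apply_eq_comp, Units.mul_inv, one_apply_eq_self]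
  set lowC := 2 * (CM / ε) + 2 / ε with hlowC
  set uppC := 1 / ε + (C + 1) * ((1 + CN) / 2) with huppC
  have hlow0 : 0 ≤ lowC := by positivity
  have hupp0 : 0 ≤ uppC := by positivity
  -- The `+ 1` makes `γ` positive and at least `1`, which covers `t = 0`.
  refine ⟨R₁, R₂, L₁, L₂, hR₂s, hL₁s, Real.sqrt (4 * (lowC * uppC)) + 1, by positivity, ?_⟩
  intro κ hκ hκμδ w w' hw hw' hinit t ht
  have hκμ : κ < μ := hκμδ.trans_le (min_le_left _ _)
  have hκδ : κ < δ := hκμδ.trans_le (min_le_right _ _)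
  set e : ℝ → ℝ → ℝ := fun x t => w' x t - w x t with he
  have hec : IsC12 e := hw.regular.sub hw'.regular
  have hVo : ∀ f : CI, ε * (∫ x in (0 : ℝ)..1, ex f x ^ 2) ≤ intCI (f * opCI N S₁ f) ∧
      intCI (f * opCI N S₁ f) ≤ (1 + CN) / 2 * ∫ x in (0 : ℝ)..1, ex f x ^ 2 := by
    intro f
    rw [intCI_mul_opCI]
    refine ⟨hN.coercive (continuous_ex f), ?_⟩
    have h1 := two_mul_integral_mul_le (continuous_ex f)
      (continuous_op N S₁ (continuous_ex f)) one_pos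
    have h2 := hopN _ (continuous_ex f)
    linarith
  -- With `z = B f` and `T = op M K₁`, the form is `⟨z, T z⟩ ≥ ε ‖z‖²`. The lower bound uses `‖f‖ =
  -- ‖T z‖`; the upper one uses Young's inequality with weight `ε`, absorbing `ε ‖z‖²` into the
  -- form.
  have hVc : ∀ f : CI, 0 ≤ intCI (f * B f) ∧
      (∫ x in (0 : ℝ)..1, ex f x ^ 2) ≤ CM / ε * intCI (f * B f) ∧
      intCI (f * B f) ≤ 1 / ε * ∫ x in (0 : ℝ)..1, ex f x ^ 2 := by
    intro f
    have hz := continuous_ex (B f)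
    have e1 : ∀ x ∈ Set.Icc (0 : ℝ) 1, ex f x = op M K₁ (ex (B f)) x := fun x hx => by
      rw [← ex_opCI M K₁ (B f) hx, hB]
    have e2 : intCI (f * B f) = ∫ x in (0 : ℝ)..1, ex (B f) x * op M K₁ (ex (B f)) x := by
      rw [← intCI_mul_opCI, hB, mul_comm]
    have e3 : ∫ x in (0 : ℝ)..1, ex f x ^ 2 = ∫ x in (0 : ℝ)..1, op M K₁ (ex (B f)) x ^ 2 :=
      integral_congr_Icc fun x hx => by rw [e1 x hx]
    have h1 := hM.coercive hz
    have h2 := hopM _ hz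
    have h3 := two_mul_integral_mul_le hz (continuous_op M K₁ hz) hε
    rw [e2, e3]
    refine ⟨(mul_nonneg hε.le (integral_sq_nonneg _)).trans h1, ?_, ?_⟩
    · refine h2.trans ?_
      rw [div_mul_eq_mul_div, le_div_iff₀ hε]
      nlinarith [mul_le_mul_of_nonneg_left h1 hCM]
    · rw [one_div]; linarith
  -- the Lyapunov function
  set V : ℝ → ℝ := fun s => intCI (slice w' s * B (slice w' s))
    + (C + 1) * intCI (slice e s * opCI N S₁ (slice e s)) with hV
  set V' : ℝ → ℝ := fun s => 2 * intCI (slice (dt w') s * B (slice w' s))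
    + (C + 1) * (2 * intCI (slice (dt e) s * opCI N S₁ (slice e s))) with hV'
  have hderiv : ∀ s > 0, HasDerivAt V (V' s) s := fun s hs =>
    (hasDerivAt_intCI_mul (hasDerivAt_slice hw'.regular hs) B (intCI_mul_inv_comm hB)).add
      ((hasDerivAt_intCI_mul (hasDerivAt_slice hec hs) _
        (intCI_mul_opCI_comm N S₁)).const_mul _)
  have hle : ∀ s > 0, V' s ≤ -(2 * κ) * V s := by
    intro s hs
    have hctr' : 2 * intCI (slice (dt w') s * B (slice w' s)) ≤
        -(2 * μ) * intCI (slice w' s * B (slice w' s)) + C * e 1 s ^ 2 := by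
      obtain ⟨f, f₁, f₂, hf, hf0, hf1, hf2⟩ := exists_hasC2 hw'.regular hs
      have hex : ∀ x ∈ Set.Icc (0 : ℝ) 1, ex (slice w' s) x = f x := fun x hx => by
        rw [ex_slice (continuousOn_slice hw'.regular.cont hs) hx, hf0 x hx]
      have key := hctr f f₁ f₂ (ex (B (slice w' s))) (e 1 s) hf (continuous_ex _)
        (fun x hx => by rw [← ex_opCI M K₁ _ hx, hB, hex x hx])
        (by rw [hf0 0 (by simp), hw'.bc_left s hs]) (by
          rw [hf1 1 (by simp), hw'.bc_right s hs, feedback, hf0 1 (by simp)]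
          congr 2
          exact integral_congr_Icc fun x hx => by rw [hf0 x hx])
      rw [intCI_apply, intCI_apply]
      refine le_trans (le_of_eq ?_) (key.trans (le_of_eq ?_))
      · congr 1
        refine integral_congr_Icc fun x hx => ?_
        rw [ex_mul, ex_slice (continuousOn_slice hw'.regular.cont_t hs) hx, hw'.pde x hx s hs,
          hf0 x hx, hf1 x hx, hf2 x hx]
      · congr 2
        exact integral_congr_Icc fun x hx => by rw [ex_mul, hex x hx]
    have hobs' : 2 * intCI (slice (dt e) s * opCI N S₁ (slice e s)) ≤
        -(2 * δ) * intCI (slice e s * opCI N S₁ (slice e s)) - e 1 s ^ 2 := by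
      obtain ⟨f, f₁, f₂, hf, hf0, hf1, hf2⟩ := exists_hasC2 hec hs
      have hex : ∀ x ∈ Set.Icc (0 : ℝ) 1, ex (slice e s) x = f x := fun x hx => by
        rw [ex_slice (continuousOn_slice hec.cont hs) hx, hf0 x hx]
      have key := hobs f f₁ f₂ hf
        (by rw [hf0 0 (by simp)]; simp only [he]; rw [hw'.bc_left s hs, hw.bc_left s hs, sub_zero])
        (by
          rw [hf1 1 (by simp), hf0 1 (by simp), dx_sub hw.regular hw'.regular (by simp) hs,
            hw'.bc_right s hs, hw.bc_right s hs]
          ring)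
      rw [intCI_mul_opCI, intCI_mul_opCI]
      refine le_trans (le_of_eq ?_) (key.trans (le_of_eq ?_))
      · congr 1
        refine integral_congr_Icc fun x hx => ?_
        rw [op_congr N S₁ hex hx, ex_slice (continuousOn_slice hec.cont_t hs) hx,
          dt_sub hw.regular hw'.regular hx hs, hw'.pde x hx s hs, hw.pde x hx s hs,
          hf0 x hx, hf1 x hx, hf2 x hx, dx_sub hw.regular hw'.regular hx hs,
          dx_dx_sub hw.regular hw'.regular hx hs, hf0 1 (by simp)]
        ring
      · rw [hf0 1 (by simp)]
        congr 2
        exact integral_congr_Icc fun x hx => by rw [op_congr N S₁ hex hx, hex x hx]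
    have p1 : 0 ≤ intCI (slice e s * opCI N S₁ (slice e s)) :=
      (mul_nonneg hε.le (integral_sq_nonneg _)).trans (hVo _).1
    have p2 : 0 ≤ intCI (slice w' s * B (slice w' s)) := (hVc _).1
    simp only [hV, hV']
    have q1 := mul_le_mul_of_nonneg_left hobs' (by positivity : 0 ≤ C + 1)
    have q2 := mul_nonneg (sub_nonneg.2 hκμ.le) p2
    have q3 := mul_nonneg (by positivity : 0 ≤ C + 1) (mul_nonneg (sub_nonneg.2 hκδ.le) p1)
    -- The weight `C + 1` turns the observer's `-e(1)²` into `-(C + 1) e(1)²`, which dominates the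
    -- disturbance `C e(1)²`.
    nlinarith [sq_nonneg (e 1 s)]
  have hγ0 : 0 ≤ Real.sqrt (4 * (lowC * uppC)) := Real.sqrt_nonneg _
  have hl0 : 0 ≤ l2norm (fun x => w x 0) := Real.sqrt_nonneg _
  rcases ht.eq_or_lt with rfl | ht
  · simp only [mul_zero, Real.exp_zero, mul_one]
    nlinarith
  -- comparison with an earlier time
  have hwt : ∫ x in (0 : ℝ)..1, w x t ^ 2 ≤ lowC * V t := by
    have h1 := (hVo (slice e t)).1
    have h2 := (hVc (slice w' t)).2.1
    have hsq : ∫ x in (0 : ℝ)..1, w x t ^ 2 ≤ 2 * (∫ x in (0 : ℝ)..1, ex (slice w' t) x ^ 2)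
        + 2 * ∫ x in (0 : ℝ)..1, ex (slice e t) x ^ 2 := by
      have hc1 := continuous_ex (slice w' t)
      have hc2 := continuous_ex (slice e t)
      have hc3 := continuous_ex (slice w t)
      rw [integral_congr_Icc (f := fun x => w x t ^ 2) (g := fun x => ex (slice w t) x ^ 2)
        (fun x hx => by rw [ex_slice (continuousOn_slice hw.regular.cont ht) hx]),
        ← intervalIntegral.integral_const_mul, ← intervalIntegral.integral_const_mul,
        ← intervalIntegral.integral_add (intervalIntegrable_unit (by fun_prop))
          (intervalIntegrable_unit (by fun_prop))]
      refine intervalIntegral.integral_mono_on zero_le_one (intervalIntegrable_unit (by fun_prop))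
        (intervalIntegrable_unit (by fun_prop)) fun x hx => ?_
      rw [ex_slice (continuousOn_slice hw.regular.cont ht) hx,
        ex_slice (continuousOn_slice hw'.regular.cont ht) hx,
        ex_slice (continuousOn_slice hec.cont ht) hx]
      simp only [he]
      nlinarith [sq_nonneg (w' x t + (w' x t - w x t))]
    have p1 : 0 ≤ intCI (slice e t * opCI N S₁ (slice e t)) :=
      (mul_nonneg hε.le (integral_sq_nonneg _)).trans h1
    have p2 : 0 ≤ intCI (slice w' t * B (slice w' t)) := (hVc _).1
    have h3 : (∫ x in (0 : ℝ)..1, ex (slice e t) x ^ 2) ≤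
        1 / ε * intCI (slice e t * opCI N S₁ (slice e t)) := by
      rw [one_div, ← div_eq_inv_mul, le_div_iff₀ hε]; linarith
    have p3 : 0 ≤ 1 / ε := by positivity
    have p4 : 0 ≤ CM / ε := by positivity
    have hexp : lowC * V t = 2 * (CM / ε * intCI (slice w' t * B (slice w' t)))
        + 2 * (1 / ε * intCI (slice e t * opCI N S₁ (slice e t)))
        + 2 * (1 / ε * intCI (slice w' t * B (slice w' t)))
        + 2 * (CM / ε * (C + 1) * intCI (slice e t * opCI N S₁ (slice e t)))
        + 2 * (1 / ε * C * intCI (slice e t * opCI N S₁ (slice e t))) := by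
      simp only [hlowC, hV]; ring
    rw [hexp]
    have r1 := mul_nonneg p3 p2
    have r2 := mul_nonneg (mul_nonneg p4 (by positivity : 0 ≤ C + 1)) p1
    have r3 := mul_nonneg (mul_nonneg p3 hC) p1
    linarith
  -- Since `‖e‖² ≤ 2‖ŵ‖² + 2‖w‖²`, the sum `‖ŵ‖² + ‖e‖²` is at most `3‖ŵ‖² + 2‖w‖²`. Comparing each
  -- with its initial state doubles the factors, and `ŵ(·, 0) = 0` contributes nothing.
  have hVs : ∀ s > 0, V s ≤ uppC * (6 * l2norm (fun x => w' x s - w' x 0) ^ 2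
      + 4 * l2norm (fun x => w x s - w x 0) ^ 2 + 4 * ∫ x in (0 : ℝ)..1, w x 0 ^ 2) := by
    intro s hs
    have h1 := (hVo (slice e s)).2
    have h2 := (hVc (slice w' s)).2.2
    have hc1 := continuous_ex (slice w' s)
    have hc2 := continuous_ex (slice e s)
    have hc3 := continuous_ex (slice w s)
    have hsq : ∫ x in (0 : ℝ)..1, ex (slice e s) x ^ 2 ≤
        2 * (∫ x in (0 : ℝ)..1, ex (slice w' s) x ^ 2)
        + 2 * ∫ x in (0 : ℝ)..1, ex (slice w s) x ^ 2 := by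
      rw [← intervalIntegral.integral_const_mul, ← intervalIntegral.integral_const_mul,
        ← intervalIntegral.integral_add (intervalIntegrable_unit (by fun_prop))
          (intervalIntegrable_unit (by fun_prop))]
      refine intervalIntegral.integral_mono_on zero_le_one (intervalIntegrable_unit (by fun_prop))
        (intervalIntegrable_unit (by fun_prop)) fun x hx => ?_
      rw [ex_slice (continuousOn_slice hw.regular.cont hs) hx,
        ex_slice (continuousOn_slice hw'.regular.cont hs) hx,
        ex_slice (continuousOn_slice hec.cont hs) hx]
      simp only [he]
      nlinarith [sq_nonneg (w' x s + w x s)]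
    have i1 := integral_sq_le_initial hw.regular hw.initial hs
    have i2 := integral_sq_le_initial hw'.regular hw'.initial hs
    have i3 : ∫ x in (0 : ℝ)..1, w' x 0 ^ 2 = 0 := by
      rw [integral_congr_Icc (g := fun _ => 0) fun x hx => by rw [hinit x hx]; ring]
      simp
    have i4 : ∫ x in (0 : ℝ)..1, ex (slice w s) x ^ 2 = ∫ x in (0 : ℝ)..1, w x s ^ 2 :=
      integral_congr_Icc fun x hx => by
        rw [ex_slice (continuousOn_slice hw.regular.cont hs) hx]
    have i5 : ∫ x in (0 : ℝ)..1, ex (slice w' s) x ^ 2 = ∫ x in (0 : ℝ)..1, w' x s ^ 2 :=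
      integral_congr_Icc fun x hx => by
        rw [ex_slice (continuousOn_slice hw'.regular.cont hs) hx]
    have n1 := integral_sq_nonneg (ex (slice w' s))
    have n2 := integral_sq_nonneg (ex (slice e s))
    have hVle : V s ≤ uppC * ((∫ x in (0 : ℝ)..1, ex (slice w' s) x ^ 2)
        + ∫ x in (0 : ℝ)..1, ex (slice e s) x ^ 2) := by
      have hA : 0 ≤ 1 / ε := by positivity
      have hD : 0 ≤ (C + 1) * ((1 + CN) / 2) := by positivity
      have m1 := mul_le_mul_of_nonneg_left h1 (by positivity : 0 ≤ C + 1)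
      have m2 := mul_nonneg hA n2
      have m3 := mul_nonneg hD n1
      simp only [huppC, hV]
      linarith
    refine hVle.trans (mul_le_mul_of_nonneg_left ?_ hupp0)
    linarith
  -- Let `s → 0+` in the decay from `s` to `t`: the distances to the initial states vanish, leaving
  -- only the initial norm of `w`.
  have hlim : ∫ x in (0 : ℝ)..1, w x t ^ 2 ≤
      lowC * (uppC * (4 * ∫ x in (0 : ℝ)..1, w x 0 ^ 2)) * Real.exp (-(2 * κ) * t) := by
    have hexp : Filter.Tendsto (fun s => Real.exp (-(2 * κ) * (t - s))) (nhdsWithin 0 (Set.Ioi 0))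
        (nhds (Real.exp (-(2 * κ) * (t - 0)))) :=
      (Continuous.tendsto (by fun_prop) 0).mono_left nhdsWithin_le_nhds
    have htend := ((((hw'.initial.tendsto.pow 2).const_mul 6).add
      ((hw.initial.tendsto.pow 2).const_mul 4)).add_const
        (4 * ∫ x in (0 : ℝ)..1, w x 0 ^ 2)).const_mul uppC |>.const_mul lowC |>.mul hexp
    simp only [ne_eq, OfNat.ofNat_ne_zero, not_false_eq_true, zero_pow, mul_zero, zero_add,
      sub_zero] at htend
    refine ge_of_tendsto htend ?_
    have hmem : Set.Ioo 0 t ∈ nhdsWithin (0 : ℝ) (Set.Ioi 0) := Ioo_mem_nhdsGT ht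
    filter_upwards [hmem] with s hs
    have h1 := exp_decay_of_hasDerivAt_le hderiv hle hs.1 hs.2.le
    have h2 := mul_le_mul_of_nonneg_right (hVs s hs.1) (Real.exp_pos (-(2 * κ) * (t - s))).le
    have h3 := mul_le_mul_of_nonneg_left (h1.trans h2) hlow0
    rw [← mul_assoc] at h3
    exact hwt.trans h3
  have hfin : l2norm (fun x => w x t) ≤
      Real.sqrt (4 * (lowC * uppC)) * l2norm (fun x => w x 0) * Real.exp (-κ * t) := by
    refine Real.sqrt_le_iff.2 ⟨by positivity, hlim.trans (le_of_eq ?_)⟩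
    rw [mul_pow, mul_pow, Real.sq_sqrt (by positivity), l2norm_sq, ← Real.exp_nat_mul]
    have : ((2 : ℕ) : ℝ) * (-κ * t) = -(2 * κ) * t := by push_cast; ring
    rw [this]; ring
  refine hfin.trans ?_
  have := mul_nonneg hl0 (Real.exp_pos (-κ * t)).le
  nlinarith
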